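/- Let $\mathbb F$ be any field, let $d,k\ge 0$, and let $F=(f_1,\dots,f_k)\in\mathbb F[[z_1,\dots,z_d]]^k$ be a tuple of formal power series. For $n\ge 0$ let $\mathbf z_1,\dots,\mathbf z_n$, $\mathbf z_j=(z_{j,1},\dots,z_{j,d})$, be disjoint $d$-tuples of variables and let $V^F(n)=[F(\mathbf z_1),\dots,F(\mathbf z_n)]$ be the $k\times n$ matrix with entries $f_i(\mathbf z_j)\in\mathbb F[[z_{j,t}]]$. For a matrix $M$ with $m$ rows and columns indexed by $[n]$ and for $A\subseteq[n]$, let $M|_A$ be the submatrix of the columns in $A$ and $M_A$ their span; for $A_1,\dots,A_\ell\subseteq[n]$ with $|A_1|+\dots+|A_\ell|=(\ell-1)m$ put $$D_M(A_1,\dots,A_\ell)=\det\begin{pmatrix} I_m & M|_{A_1} & & & \\ I_m & & M|_{A_2} & & \\ \vdots & & & \ddots & \\ I_m & & & & M|_{A_\ell}\end{pmatrix}.$$ A generic $m\times n$ matrix is one whose entries are independent variables over $\mathbb F$. For $\ell\ge 1$, $F$ is $\operatorname{MDS}(\ell)$ if, with $n=(\ell-1)k$ and $W$ the generic $k\times n$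 matrix, for all $A_1,\dots,A_\ell\subseteq[n]$ with $|A_i|\le k$ and $\sum_i|A_i|=(\ell-1)k$: $W_{A_1}\cap\dots\cap W_{A_\ell}=0$ if and only if $D_{V^F(n)}(A_1,\dots,A_\ell)\ne 0$. $F$ is $\operatorname{MDS}$ if it is $\operatorname{MDS}(2)$. For $\ell\ge 1$, $F$ is $\operatorname{LD-MDS}(\le\ell)$ if for every $n\ge k$ the matrix $V^F(n)$ has rank $k$ over the fraction field $K$ of $\mathbb F[[z_{j,t}]]$ and, with $W$ the generic $(n-k)\times n$ matrix, for all $A_1,\dots,A_{\ell+1}\subseteq[n]$ with $|A_i|\le n-k$ and $\sum_i|A_i|=\ell(n-k)$: $W_{A_1}\cap\dots\cap W_{A_{\ell+1}}=0$ if and only if $D_Q(A_1,\dots,A_{\ell+1})\neq 0$ for every dual matrix $Q$ of $V^F(n)$, i.e. every $(n-k)\times n$ matrix $Q$ over $K$ of rank $n-k$ with $V^F(n)\,Q^{T}=0$. **Theorem.** $F$ is $\operatorname{MDS}$ if and only if $F$ is $\operatorname{MDS}(\ell)$ for all $\ell>2$. Moreover, if $F$ is $\operatorname{MDS}$, then $F$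 is $\operatorname{LD-MDS}(\le\ell)$ for all $\ell\ge 1$. -/

import Mathlib

namespace HigherOrderMDS

open Matrix

noncomputable section

/-- The generic `k × n` matrix over `F`: its entries are independent formal variables, viewed in
the field of rational functions in these `k * n` variables over `F`. -/
def genericMatrix (F : Type*) [Field F] (k n : ℕ) :
    Matrix (Fin k) (Fin n) (FractionRing (MvPolynomial (Fin k × Fin n) F)) :=
  Matrix.of fun i j => algebraMap (MvPolynomial (Fin k × Fin n) F) _ (MvPolynomial.X (i, j))

/-- `V_A`: the span of the columns of `V` with index in `A`. -/
def colSpan {K : Type*} [Field K] {k n : ℕ} (V : Matrix (Fin k) (Fin n) K) (A : Finset (Fin n)) :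
    Submodule K (Fin k → K) :=
  Submodule.span K (V.col '' (A : Set (Fin n)))

/-- `V_{A_1} ∩ ⋯ ∩ V_{A_ℓ} = 0` for the generic `k × n` matrix `V` over `F`. -/
def GenericNullIntersection (F : Type*) [Field F] (k : ℕ) {n ℓ : ℕ}
    (A : Fin ℓ → Finset (Fin n)) : Prop :=
  ⨅ i, colSpan (genericMatrix F k n) (A i) = ⊥

/-- The block matrix with `ℓ` blocks of `k` rows, the `i`-th of which is
`(I_k | 0 ⋯ 0 | V|_{A_i} | 0 ⋯ 0)`, with `V|_{A_i}` in the `i`-th of the `ℓ` blocks of columns that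
follow the column block of the identity matrices. -/
def blockMatrix {R : Type*} [CommRing R] {k n ℓ : ℕ} (V : Matrix (Fin k) (Fin n) R)
    (A : Fin ℓ → Finset (Fin n)) :
    Matrix (Fin ℓ × Fin k) (Fin k ⊕ (Σ i : Fin ℓ, {j : Fin n // j ∈ A i})) R :=
  Matrix.of fun p => Sum.elim
    (fun j => if p.2 = j then 1 else 0)
    (fun c => if p.1 = c.1 then V p.2 c.2 else 0)

/-- A matrix is square with nonzero determinant, where rows and columns are identified by a
bijection of the index sets. The choice of the bijection only affects the sign of the
determinant. -/
def HasNonzeroDet {R m n : Type*} [CommRing R] [Fintype m] [DecidableEq m] (M : Matrix m n R) :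
    Prop :=
  ∃ e : m ≃ n, (M.submatrix id e).det ≠ 0

/-- `V^F = [F(z_1), …, F(z_n)]` for a tuple `F = (f_1, …, f_k)` of power series in `d` variables,
where `z_1, …, z_n` are disjoint `d`-tuples of variables `z_j = (z_{j,1}, …, z_{j,d})`: the
`(i, j)` entry is `f_i(z_j)`, a power series in the `n * d` variables `z_{j,t}`. -/
def evalMatrix {F : Type*} [Field F] {d k : ℕ} (f : Fin k → MvPowerSeries (Fin d) F) (n : ℕ) :
    Matrix (Fin k) (Fin n) (MvPowerSeries (Fin n × Fin d) F) :=
  Matrix.of fun i j => MvPowerSeries.rename (fun t : Fin d => (j, t)) (f i)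

/-- The `MDS(ℓ)` property (`ℓ ≥ 1`) of a tuple of power series. -/
def IsMDSOrder {F : Type*} [Field F] {d k : ℕ} (ℓ : ℕ) (f : Fin k → MvPowerSeries (Fin d) F) :
    Prop :=
  ∀ A : Fin ℓ → Finset (Fin ((ℓ - 1) * k)),
    (∀ i, (A i).card ≤ k) → ∑ i, (A i).card = (ℓ - 1) * k →
      (GenericNullIntersection F k A ↔ HasNonzeroDet (blockMatrix (evalMatrix f ((ℓ - 1) * k)) A))

/-- The `MDS` property is the `MDS(2)` property. -/
def IsMDS {F : Type*} [Field F] {d k : ℕ} (f : Fin k → MvPowerSeries (Fin d) F) : Prop :=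
  IsMDSOrder 2 f

/-- `Q ∈ V^⊥`: `Q` is a dual matrix of `V`, that is, `Q` is an `(n - k) × n` matrix of rank `n - k`
all of whose rows are orthogonal to all rows of `V`. (Used for `k ≤ n` and `V` of rank `k`.) -/
def IsDualMatrix {K : Type*} [Field K] {k n : ℕ} (V : Matrix (Fin k) (Fin n) K)
    (Q : Matrix (Fin (n - k)) (Fin n) K) : Prop :=
  Q.rank = n - k ∧ V * Qᵀ = 0

/-- `V^F` over the field of fractions of the ring of power series in the variables `z_{j,t}`. -/
def evalMatrixFrac {F : Type*} [Field F] {d k : ℕ} (f : Fin k → MvPowerSeries (Fin d) F) (n : ℕ) :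
    Matrix (Fin k) (Fin n) (FractionRing (MvPowerSeries (Fin n × Fin d) F)) :=
  (evalMatrix f n).map (algebraMap _ _)

/-- The `LD-MDS(≤ ℓ)` property of a tuple of power series: for every length `n ≥ k`, the matrix
`V^F` has rank `k`, and its dual satisfies the determinantal `[n, n - k]`-`MDS(ℓ + 1)` condition. -/
def IsLDMDS {F : Type*} [Field F] {d k : ℕ} (ℓ : ℕ) (f : Fin k → MvPowerSeries (Fin d) F) :
    Prop :=
  ∀ n : ℕ, k ≤ n →
    (evalMatrixFrac f n).rank = k ∧
    ∀ A : Fin (ℓ + 1) → Finset (Fin n),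
      (∀ i, (A i).card ≤ n - k) → ∑ i, (A i).card = ℓ * (n - k) →
        (GenericNullIntersection F (n - k) A ↔
          ∀ Q : Matrix (Fin (n - k)) (Fin n) (FractionRing (MvPowerSeries (Fin n × Fin d) F)),
            IsDualMatrix (evalMatrixFrac f n) Q → HasNonzeroDet (blockMatrix Q A))

end

end HigherOrderMDS

/-!
All the properties in question are equivalent to the linear independence of `f_1, …, f_k` over `F`.
Applied to disjoint blocks of `k` columns and the empty set, `MDS(ℓ)` with `ℓ ≥ 2` implies linear
independence (`linearIndependent_of_isMDSOrder`), and linear independence implies `MDS(ℓ)` and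
`LD-MDS(≤ ℓ)` for all `ℓ ≥ 1` (`isMDSOrder_of_linearIndependent`, `isLDMDS_of_linearIndependent`).

A nonzero determinant for some matrix forces one for the generic matrix, so only one direction
of each equivalence needs an argument. The determinant of the block matrix of `V` is nonzero if and
only if the annihilators of the columns `V|_{A_i}` are independent
(`hasNonzeroDet_blockMatrix_iff`). For the generic matrix this implies, by counting dimensions,
`|⋂_{i ∈ I} A_i| + ∑_{i ∈ I} (k - |A_i|) ≤ k` for every nonempty set `I` of indices
(`GenericNullIntersection.annihilatorCondition`). It remains to see that these inequalities suffice
for the matrix `V^F`.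

After a change of basis, the `f_s` have strictly increasing orders with respect to the lexicographic
order of monomials (`exists_strictMono_lexOrder`). Then the column `F(z_j)` tends, up to scaling, to
the first unit vector as `z_j` tends to the origin; modulo the first `r` unit vectors, it tends to
the next one. Independence in the limit implies independence of the original spaces, since the
leading coefficients of a nontrivial linear relation form a nontrivial relation in the limit
(`exists_leadingCoeff`). So one considers, more generally, the annihilators of the columns in `A_i`
together with the first `r_i` unit vectors, and argues by induction, following Lovett's proof of
the GM-MDS theorem (`indepOn_annihilator`). If the inequality is an equality for a proper
subfamily with at least two members, then the subfamily can be replaced by the annihilator of its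
common part. Otherwise every proper subfamily leaves room for moving one point to the origin, and
the inequality for the whole family persists for a suitable point. If there is no such point, then
all the spaces but one are contained in the hyperplane where the next coordinate vanishes, and the
remaining space can be replaced by its intersection with this hyperplane.

For the dual statement, the annihilators of columns of a dual matrix `Q` are identified with the
spaces of linear dependencies between the columns of `V^F` with index in `B_i`, the complement of
`A_i` (`IsDualMatrix.indepOn_annihilator`), and the inequalities become
`∑_{i ∈ I} (|B_i| - k) + k ≤ |⋃_{i ∈ I} B_i|`. The same degeneration and the same kind of induction
apply (`indepOn_dependencies`), with a point from a set `B_i` that comes with the largest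
number of unit vectors.
-/

namespace HigherOrderMDS

open Matrix

noncomputable section

/-! ### Leading coefficients with respect to one block of variables -/

/-- The underlying function of `sumToIter`. -/
def sumToIterFun {σ τ R : Type*} [CommRing R] (a : MvPowerSeries (σ ⊕ τ) R) :
    MvPowerSeries τ (MvPowerSeries σ R) :=
  fun m => (fun e => MvPowerSeries.coeff (Finsupp.sumElim e m) a : MvPowerSeries σ R)

theorem coeff_coeff_sumToIterFun {σ τ R : Type*} [CommRing R] (a : MvPowerSeries (σ ⊕ τ) R)
    (m : τ →₀ ℕ) (e : σ →₀ ℕ) :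
    MvPowerSeries.coeff e (MvPowerSeries.coeff m (sumToIterFun a)) =
      MvPowerSeries.coeff (Finsupp.sumElim e m) a := rfl

/-- Power series in the variables `σ ⊕ τ`, read as power series in the variables `τ` whose
coefficients are power series in the variables `σ`. -/
def sumToIter (σ τ R : Type*) [CommRing R] :
    MvPowerSeries (σ ⊕ τ) R →+* MvPowerSeries τ (MvPowerSeries σ R) where
  toFun := sumToIterFun
  map_one' := by
    classical
    ext m e
    have h : Finsupp.sumElim e m = 0 ↔ e = 0 ∧ m = 0 := by
      simpa [Prod.ext_iff] using
        (Finsupp.sumFinsuppAddEquivProdFinsupp (M := ℕ) (α := σ) (β := τ)).symm.map_eq_zero_iff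
          (x := (e, m))
    rw [coeff_coeff_sumToIterFun, MvPowerSeries.coeff_one, MvPowerSeries.coeff_one,
      if_congr h rfl rfl]
    by_cases hm : m = 0 <;> by_cases he : e = 0 <;> simp [hm, he, MvPowerSeries.coeff_one]
  map_zero' := by
    ext m e
    rw [coeff_coeff_sumToIterFun, map_zero, map_zero, map_zero]
  map_add' a b := by
    ext m e
    rw [coeff_coeff_sumToIterFun, map_add, map_add, map_add, coeff_coeff_sumToIterFun,
      coeff_coeff_sumToIterFun]
  map_mul' a b := by
    classical
    ext m e
    rw [coeff_coeff_sumToIterFun, MvPowerSeries.coeff_mul, MvPowerSeries.coeff_mul, map_sum]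
    simp only [MvPowerSeries.coeff_mul]
    rw [← Finset.sum_product']
    let E := Finsupp.sumFinsuppAddEquivProdFinsupp (M := ℕ) (α := σ) (β := τ)
    have hE : ∀ e m, Finsupp.sumElim e m = E.symm (e, m) := fun _ _ => rfl
    refine Finset.sum_nbij' (fun p => (((E p.1).2, (E p.2).2), ((E p.1).1, (E p.2).1)))
      (fun q => (E.symm (q.2.1, q.1.1), E.symm (q.2.2, q.1.2))) ?_ ?_ ?_ ?_ ?_
    · rintro ⟨p, q⟩ h
      rw [Finset.HasAntidiagonal.mem_antidiagonal, hE] at h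
      have h' : E p + E q = (e, m) := by rw [← map_add, h, E.apply_symm_apply]
      simp only [Finset.mem_product, Finset.HasAntidiagonal.mem_antidiagonal]
      exact ⟨congrArg Prod.snd h', congrArg Prod.fst h'⟩
    · rintro ⟨⟨p, q⟩, ⟨p', q'⟩⟩ h
      simp only [Finset.mem_product, Finset.HasAntidiagonal.mem_antidiagonal] at h
      rw [Finset.HasAntidiagonal.mem_antidiagonal, hE, ← map_add, Prod.mk_add_mk, h.1, h.2]
    · rintro ⟨p, q⟩ _
      simp
    · rintro ⟨⟨p, q⟩, ⟨p', q'⟩⟩ _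
      simp
    · rintro ⟨p, q⟩ _
      rw [coeff_coeff_sumToIterFun, coeff_coeff_sumToIterFun, hE, hE]
      simp

theorem coeff_coeff_sumToIter {σ τ R : Type*} [CommRing R] (a : MvPowerSeries (σ ⊕ τ) R)
    (m : τ →₀ ℕ) (e : σ →₀ ℕ) :
    MvPowerSeries.coeff e (MvPowerSeries.coeff m (sumToIter σ τ R a)) =
      MvPowerSeries.coeff (Finsupp.sumElim e m) a := rfl

theorem sumToIter_injective (σ τ R : Type*) [CommRing R] :
    Function.Injective (sumToIter σ τ R) := by
  intro a b h
  ext p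
  let E := Finsupp.sumFinsuppAddEquivProdFinsupp (M := ℕ) (α := σ) (β := τ)
  have h1 := coeff_coeff_sumToIter a (E p).2 (E p).1
  rw [h, coeff_coeff_sumToIter] at h1
  have h2 : Finsupp.sumElim (E p).1 (E p).2 = p := E.symm_apply_apply p
  rw [h2] at h1
  exact h1.symm

theorem sumToIter_rename_inl {σ τ R : Type*} [Finite σ] [CommRing R] (a : MvPowerSeries σ R) :
    sumToIter σ τ R (MvPowerSeries.rename Sum.inl a) = MvPowerSeries.C a := by
  classical
  ext m e
  rw [coeff_coeff_sumToIter, MvPowerSeries.coeff_C]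
  split_ifs with hm
  · have : Finsupp.sumElim e m = Finsupp.embDomain (Function.Embedding.inl : σ ↪ σ ⊕ τ) e := by
      ext (x | x)
      · rw [Finsupp.sumElim_inl]
        exact (Finsupp.embDomain_apply_self (Function.Embedding.inl : σ ↪ σ ⊕ τ) e x).symm
      · rw [Finsupp.sumElim_inr, Finsupp.embDomain_of_notMem_range _ _ _ (by simp), hm]
        rfl
    rw [this]
    exact MvPowerSeries.coeff_embDomain_rename (Function.Embedding.inl : σ ↪ σ ⊕ τ) a e
  · rw [map_zero]
    apply MvPowerSeries.coeff_rename_eq_zero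
    rintro ⟨y, hy⟩
    apply hm
    ext x
    have := DFunLike.congr_fun hy (Sum.inr x)
    rw [Finsupp.sumElim_inr, Finsupp.mapDomain_of_notMem_range _ _ (by simp)] at this
    simpa using this.symm

theorem sumToIter_rename_inr {σ τ R : Type*} [Finite τ] [CommRing R] (a : MvPowerSeries τ R) :
    sumToIter σ τ R (MvPowerSeries.rename Sum.inr a) = MvPowerSeries.map MvPowerSeries.C a := by
  classical
  ext m e
  rw [coeff_coeff_sumToIter, MvPowerSeries.coeff_map, MvPowerSeries.coeff_C]
  split_ifs with he
  · have : Finsupp.sumElim e m = Finsupp.embDomain (Function.Embedding.inr : τ ↪ σ ⊕ τ) m := by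
      ext (x | x)
      · rw [Finsupp.sumElim_inl, Finsupp.embDomain_of_notMem_range _ _ _ (by simp), he]
        rfl
      · rw [Finsupp.sumElim_inr]
        exact (Finsupp.embDomain_apply_self (Function.Embedding.inr : τ ↪ σ ⊕ τ) m x).symm
    rw [this]
    exact MvPowerSeries.coeff_embDomain_rename (Function.Embedding.inr : τ ↪ σ ⊕ τ) a m
  · apply MvPowerSeries.coeff_rename_eq_zero
    rintro ⟨y, hy⟩
    apply he
    ext x
    have := DFunLike.congr_fun hy (Sum.inl x)
    rw [Finsupp.sumElim_inl, Finsupp.mapDomain_of_notMem_range _ _ (by simp)] at this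
    simpa using this.symm

section

variable {F : Type*} [Field F] {d k n : ℕ}

/-- The embedding of variables which moves the `j`-th block to a new copy of the variables of
a single point and keeps all other variables. -/
def splitBlock (d : ℕ) (j : Fin n) : Fin n × Fin d ↪ (Fin n × Fin d) ⊕ Fin d where
  toFun p := if p.1 = j then Sum.inr p.2 else Sum.inl p
  inj' := by
    rintro ⟨a, s⟩ ⟨b, t⟩ h
    dsimp only at h
    split_ifs at h with h1 h2 h2
    · rw [h1, h2, Sum.inr_injective h]
    · exact Sum.inl_injective h

/-- Power series in all the variables `z_{j', t}`, expanded as power series in the block `z_j`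
of variables. -/
def expandAt (F : Type*) [Field F] (d : ℕ) (j : Fin n) :
    MvPowerSeries (Fin n × Fin d) F →+* MvPowerSeries (Fin d) (MvPowerSeries (Fin n × Fin d) F) :=
  (sumToIter _ _ F).comp (MvPowerSeries.rename (splitBlock d j)).toRingHom

theorem expandAt_injective (j : Fin n) : Function.Injective (expandAt F d j) :=
  (sumToIter_injective _ _ F).comp (MvPowerSeries.rename_injective (splitBlock d j))

theorem expandAt_evalMatrix_self (f : Fin k → MvPowerSeries (Fin d) F) (j : Fin n) (s : Fin k) :
    expandAt F d j (evalMatrix f n s j) = MvPowerSeries.map MvPowerSeries.C (f s) := by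
  rw [← sumToIter_rename_inr]
  change sumToIter _ _ F (MvPowerSeries.rename (splitBlock d j)
    (MvPowerSeries.rename (fun t : Fin d => (j, t)) (f s))) = _
  rw [MvPowerSeries.rename_rename]
  have : (splitBlock d j ∘ fun t : Fin d => (j, t)) = Sum.inr := by
    funext t
    exact if_pos rfl
  congr 1
  simp only [this]

theorem expandAt_evalMatrix_of_ne (f : Fin k → MvPowerSeries (Fin d) F) {j j' : Fin n}
    (h : j' ≠ j) (s : Fin k) :
    expandAt F d j (evalMatrix f n s j') = MvPowerSeries.C (evalMatrix f n s j') := by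
  rw [← sumToIter_rename_inl]
  change sumToIter _ _ F (MvPowerSeries.rename (splitBlock d j)
    (MvPowerSeries.rename (fun t : Fin d => (j', t)) (f s))) =
    sumToIter _ _ F (MvPowerSeries.rename Sum.inl
    (MvPowerSeries.rename (fun t : Fin d => (j', t)) (f s)))
  rw [MvPowerSeries.rename_rename, MvPowerSeries.rename_rename]
  have : (splitBlock d j ∘ fun t : Fin d => (j', t)) = Sum.inl ∘ fun t : Fin d => (j', t) := by
    funext t
    exact if_neg h
  congr 1
  simp only [this]

/-- Degeneration of the point `z_j` towards the origin. A finite family `x`, not identically zero,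
is replaced by its coefficients `L (x ν)` at the lexicographically smallest monomial in `z_j` that
occurs in it. The map `L` is linear over the other points, and a linear relation
`∑ y_s f_s(z_j) = 0` leaves, in lowest order, only its first term, as the `f_s` have increasing
orders. -/
theorem exists_leadingCoeff {f : Fin k → MvPowerSeries (Fin d) F} (hf0 : ∀ s, f s ≠ 0)
    (hf : StrictMono fun s => MvPowerSeries.lexOrder (f s)) (j : Fin n)
    {N : Type*} [Finite N] (x : N → MvPowerSeries (Fin n × Fin d) F) (hx : ∃ ν, x ν ≠ 0) :
    ∃ (Y : AddSubgroup (MvPowerSeries (Fin n × Fin d) F))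
      (L : MvPowerSeries (Fin n × Fin d) F →+ MvPowerSeries (Fin n × Fin d) F),
      (∀ ν, x ν ∈ Y) ∧ (∃ ν, L (x ν) ≠ 0) ∧
      (∀ y ∈ Y, ∀ j' ≠ j, ∀ s, y * evalMatrix f n s j' ∈ Y) ∧
      (∀ y, ∀ j' ≠ j, ∀ s, L (y * evalMatrix f n s j') = L y * evalMatrix f n s j') ∧
      ∀ (y : Fin k → MvPowerSeries (Fin n × Fin d) F) (r : Fin k), (∀ s, y s ∈ Y) →
        (∀ s < r, y s = 0) → ∑ s, y s * evalMatrix f n s j = 0 → L (y r) = 0 := by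
  classical
  obtain ⟨ν₁, hν₁⟩ := hx
  have : Nonempty N := ⟨ν₁⟩
  obtain ⟨ν₀, hν₀⟩ := Finite.exists_min fun ν => MvPowerSeries.lexOrder (expandAt F d j (x ν))
  have hne : expandAt F d j (x ν₀) ≠ 0 := by
    intro h
    have := hν₀ ν₁
    rw [h, MvPowerSeries.lexOrder_zero, top_le_iff, MvPowerSeries.lexOrder_eq_top_iff_eq_zero]
      at this
    exact hν₁ (expandAt_injective j (this.trans (map_zero _).symm))
  obtain ⟨m, hm⟩ := MvPowerSeries.exists_finsupp_eq_lexOrder_of_ne_zero hne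
  refine ⟨{ carrier := {y | ((toLex m : Lex (Fin d →₀ ℕ)) : WithTop (Lex (Fin d →₀ ℕ))) ≤
              MvPowerSeries.lexOrder (expandAt F d j y)}
            add_mem' := ?_, zero_mem' := ?_, neg_mem' := ?_ },
    ((MvPowerSeries.coeff m).toAddMonoidHom.comp (expandAt F d j).toAddMonoidHom), ?_, ?_, ?_, ?_,
    ?_⟩
  · intro a b ha hb
    rw [Set.mem_ofPred_eq, map_add]
    exact le_trans (le_min ha hb) MvPowerSeries.min_lexOrder_le
  · simp
  · intro a ha
    rw [Set.mem_ofPred_eq, MvPowerSeries.le_lexOrder_iff] at ha ⊢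
    intro e he
    rw [map_neg, map_neg, ha e he, neg_zero]
  · intro ν
    change ((toLex m : Lex (Fin d →₀ ℕ)) : WithTop (Lex (Fin d →₀ ℕ))) ≤ _
    rw [← hm]
    exact hν₀ ν
  · exact ⟨ν₀, MvPowerSeries.coeff_ne_zero_of_lexOrder hm.symm⟩
  · intro y hy j' hj' s
    change ((toLex m : Lex (Fin d →₀ ℕ)) : WithTop (Lex (Fin d →₀ ℕ))) ≤ _ at hy ⊢
    rw [MvPowerSeries.le_lexOrder_iff] at hy ⊢
    intro e he
    rw [map_mul, expandAt_evalMatrix_of_ne f hj', MvPowerSeries.coeff_mul_C, hy e he, zero_mul]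
  · intro y j' hj' s
    change MvPowerSeries.coeff m (expandAt F d j _) = MvPowerSeries.coeff m (expandAt F d j _) * _
    rw [map_mul, expandAt_evalMatrix_of_ne f hj', MvPowerSeries.coeff_mul_C]
  · intro y r hY hr hsum
    replace hY : ∀ s, ((toLex m : Lex (Fin d →₀ ℕ)) : WithTop (Lex (Fin d →₀ ℕ))) ≤
      MvPowerSeries.lexOrder (expandAt F d j (y s)) := hY
    change MvPowerSeries.coeff m (expandAt F d j (y r)) = 0
    obtain ⟨μ, hμ⟩ := MvPowerSeries.exists_finsupp_eq_lexOrder_of_ne_zero (hf0 r)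
    have hC : ∀ s e, MvPowerSeries.coeff e (MvPowerSeries.map
        (MvPowerSeries.C (σ := Fin n × Fin d)) (f s)) = 0 ↔ MvPowerSeries.coeff e (f s) = 0 := by
      intro s e
      rw [MvPowerSeries.coeff_map]
      exact map_eq_zero_iff _ (MvPowerSeries.C_injective)
    have hord : ∀ s, MvPowerSeries.lexOrder (MvPowerSeries.map
        (MvPowerSeries.C (σ := Fin n × Fin d)) (f s)) = MvPowerSeries.lexOrder (f s) := by
      intro s
      apply le_antisymm
      · rw [MvPowerSeries.le_lexOrder_iff]
        exact fun e he => (hC s e).1 (MvPowerSeries.coeff_eq_zero_of_lt_lexOrder he)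
      · rw [MvPowerSeries.le_lexOrder_iff]
        exact fun e he => (hC s e).2 (MvPowerSeries.coeff_eq_zero_of_lt_lexOrder he)
    by_contra hL
    have hyr : MvPowerSeries.lexOrder (expandAt F d j (y r)) = toLex m :=
      le_antisymm (MvPowerSeries.lexOrder_le_of_coeff_ne_zero hL) (hY r)
    have key := congrArg (fun a => MvPowerSeries.coeff (m + μ) (expandAt F d j a)) hsum
    simp only [map_sum, map_zero, map_mul, expandAt_evalMatrix_self] at key
    rw [Finset.sum_eq_single r] at key
    · rw [MvPowerSeries.coeff_mul_of_add_lexOrder hyr ((hord r).trans hμ), mul_eq_zero] at key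
      refine key.elim hL fun h => ?_
      exact MvPowerSeries.coeff_ne_zero_of_lexOrder hμ.symm ((hC r μ).1 h)
    · intro s _ hs
      rcases lt_or_gt_of_ne hs with h | h
      · rw [hr s h, map_zero, zero_mul, map_zero]
      · apply MvPowerSeries.coeff_eq_zero_of_lt_lexOrder
        refine lt_of_lt_of_le ?_ (MvPowerSeries.le_lexOrder_mul _ _)
        rw [hord s]
        have h1 : MvPowerSeries.lexOrder (f r) < MvPowerSeries.lexOrder (f s) := hf h
        rw [hμ] at h1
        refine lt_of_lt_of_le ?_ (add_le_add_left (hY s) _)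
        rw [toLex_add, WithTop.coe_add]
        exact WithTop.add_lt_add_left (WithTop.coe_ne_top) h1
    · simp

end

/-! ### Tuples of power series with increasing orders -/

section

variable {F : Type*} [Field F] {d k n : ℕ}

theorem exists_strictMono_lexOrder_of_finrank_eq (m : ℕ) :
    ∀ (L : Submodule F (MvPowerSeries (Fin d) F)) [Module.Finite F L], Module.finrank F L = m →
      ∃ b : Fin m → MvPowerSeries (Fin d) F, (∀ i, b i ∈ L) ∧ (∀ i, b i ≠ 0) ∧
        StrictMono fun i => MvPowerSeries.lexOrder (b i) := by
  induction m with
  | zero => exact fun L _ _ => ⟨Fin.elim0, fun i => i.elim0, fun i => i.elim0, fun i => i.elim0⟩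
  | succ m ih =>
    intro L _ hL
    have hne : L ≠ ⊥ := by
      rintro rfl
      simp at hL
    obtain ⟨a, haL, ha0⟩ := L.ne_bot_iff.1 hne
    obtain ⟨b₀, ⟨hb₀L, hb₀⟩, hmin⟩ := WellFounded.has_min
      (InvImage.wf (fun f : MvPowerSeries (Fin d) F => MvPowerSeries.lexOrder f) wellFounded_lt)
      {f | f ∈ L ∧ f ≠ 0} ⟨a, haL, ha0⟩
    obtain ⟨μ, hμ⟩ := MvPowerSeries.exists_finsupp_eq_lexOrder_of_ne_zero hb₀
    -- the elements of `L` of order larger than `μ` form a hyperplane of `L`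
    let φ : L →ₗ[F] F := (MvPowerSeries.coeff μ).comp L.subtype
    have hφ : LinearMap.range φ = ⊤ := by
      rw [LinearMap.range_eq_top]
      refine LinearMap.surjective fun h => ?_
      exact MvPowerSeries.coeff_ne_zero_of_lexOrder hμ.symm (LinearMap.congr_fun h ⟨b₀, hb₀L⟩)
    have hker : Module.finrank F (LinearMap.ker φ) = m := by
      have := φ.finrank_range_add_finrank_ker
      rw [hφ, finrank_top, Module.finrank_self, hL] at this
      omega
    obtain ⟨b, hbL, hb0, hb⟩ := ih ((LinearMap.ker φ).map L.subtype)
      ((Submodule.finrank_map_subtype_eq L (LinearMap.ker φ)).trans hker)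
    have hbL' : ∀ i, b i ∈ L ∧ MvPowerSeries.coeff μ (b i) = 0 := by
      intro i
      obtain ⟨x, hx, hxb⟩ := hbL i
      rw [← hxb]
      exact ⟨x.2, hx⟩
    have hlt : ∀ i, MvPowerSeries.lexOrder b₀ < MvPowerSeries.lexOrder (b i) := by
      intro i
      refine lt_of_le_of_ne (not_lt.1 (hmin (b i) ⟨(hbL' i).1, hb0 i⟩)) fun h => ?_
      exact MvPowerSeries.coeff_ne_zero_of_lexOrder (hμ.symm.trans h) (hbL' i).2
    refine ⟨Fin.cons b₀ b, ?_, ?_, ?_⟩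
    · exact Fin.cases hb₀L fun i => (hbL' i).1
    · exact Fin.cases hb₀ hb0
    · intro i j
      refine Fin.cases ?_ (fun i => ?_) i <;> refine Fin.cases ?_ (fun j => ?_) j
      · simp
      · intro _
        simpa using hlt j
      · intro h
        exact absurd h (Fin.not_lt_zero _)
      · intro h
        simpa using hb (Fin.succ_lt_succ_iff.1 h)

theorem linearIndependent_of_strictMono_lexOrder {b : Fin k → MvPowerSeries (Fin d) F}
    (hb0 : ∀ i, b i ≠ 0) (hb : StrictMono fun i => MvPowerSeries.lexOrder (b i)) :
    LinearIndependent F b := by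
  rw [Fintype.linearIndependent_iff]
  intro c hc i
  induction i using WellFoundedLT.induction with
  | ind i ih =>
    obtain ⟨μ, hμ⟩ := MvPowerSeries.exists_finsupp_eq_lexOrder_of_ne_zero (hb0 i)
    have key := congrArg (MvPowerSeries.coeff μ) hc
    rw [map_sum, map_zero, Finset.sum_eq_single i, map_smul, smul_eq_mul, mul_eq_zero] at key
    · exact key.resolve_right (MvPowerSeries.coeff_ne_zero_of_lexOrder hμ.symm)
    · intro s _ hs
      rw [map_smul, smul_eq_mul]
      rcases lt_or_gt_of_ne hs with h | h
      · rw [ih s h, zero_mul]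
      · rw [MvPowerSeries.coeff_eq_zero_of_lt_lexOrder, mul_zero]
        rw [← hμ]
        exact hb h
    · simp

/-- A linearly independent tuple of power series can be transformed, by an invertible matrix
over the ground field, into one with strictly increasing orders. -/
theorem exists_strictMono_lexOrder {f : Fin k → MvPowerSeries (Fin d) F}
    (hf : LinearIndependent F f) :
    ∃ (b : Fin k → MvPowerSeries (Fin d) F) (G H : Matrix (Fin k) (Fin k) F),
      (∀ i, b i ≠ 0) ∧ (StrictMono fun i => MvPowerSeries.lexOrder (b i)) ∧
      (∀ s, b s = ∑ i, G s i • f i) ∧ (∀ s, f s = ∑ i, H s i • b i) ∧ H * G = 1 := by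
  have := FiniteDimensional.span_of_finite F (Set.finite_range f)
  obtain ⟨b, hbL, hb0, hb⟩ := exists_strictMono_lexOrder_of_finrank_eq k
    (Submodule.span F (Set.range f)) (by rw [finrank_span_eq_card hf, Fintype.card_fin])
  have hspan : Submodule.span F (Set.range b) = Submodule.span F (Set.range f) := by
    apply Submodule.eq_of_le_of_finrank_eq
    · rw [Submodule.span_le]
      rintro _ ⟨i, rfl⟩
      exact hbL i
    · rw [finrank_span_eq_card hf, finrank_span_eq_card
        (linearIndependent_of_strictMono_lexOrder hb0 hb)]
  have hG : ∀ s, ∃ c : Fin k → F, ∑ i, c i • f i = b s := fun s =>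
    (Submodule.mem_span_range_iff_exists_fun F).1 (hbL s)
  have hH : ∀ s, ∃ c : Fin k → F, ∑ i, c i • b i = f s := fun s =>
    (Submodule.mem_span_range_iff_exists_fun F).1 (hspan ▸ Submodule.subset_span ⟨s, rfl⟩)
  choose G hG using hG
  choose H hH using hH
  refine ⟨b, Matrix.of G, Matrix.of H, hb0, hb, fun s => (hG s).symm, fun s => (hH s).symm, ?_⟩
  ext s t
  have h1 : ∑ t, (∑ i, H s i * G i t) • f t = f s := by
    rw [← hH s]
    simp_rw [← hG, Finset.smul_sum, Finset.sum_smul, mul_smul]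
    exact Finset.sum_comm
  have h2 : ∑ t, (1 : Matrix (Fin k) (Fin k) F) s t • f t = f s := by
    simp [Matrix.one_apply]
  have h3 : ∑ t, (∑ i, H s i * G i t - (1 : Matrix (Fin k) (Fin k) F) s t) • f t = 0 := by
    simp_rw [sub_smul, Finset.sum_sub_distrib, h1, h2, sub_self]
  rw [Matrix.mul_apply]
  exact sub_eq_zero.1 (Fintype.linearIndependent_iff.1 hf _ h3 t)

end

/-! ### Annihilators and dependencies of columns -/

/-- The submodules `X i`, `i ∈ S`, are independent: their sum is direct. -/
def IndepOn {ι R E : Type*} [Semiring R] [AddCommMonoid E] [Module R E] (S : Finset ι)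
    (X : ι → Submodule R E) : Prop :=
  ∀ g : ι → E, (∀ i ∈ S, g i ∈ X i) → ∑ i ∈ S, g i = 0 → ∀ i ∈ S, g i = 0

section

variable {R : Type*} [CommRing R] {k n : ℕ}

/-- The vectors which are orthogonal to the columns of `V` with index in `A` and to the first `r`
unit vectors. -/
def annihilator (V : Matrix (Fin k) (Fin n) R) (A : Finset (Fin n)) (r : ℕ) :
    Submodule R (Fin k → R) where
  carrier := {g | (∀ s : Fin k, s.val < r → g s = 0) ∧ ∀ j ∈ A, ∑ s, g s * V s j = 0}
  zero_mem' := by simp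
  add_mem' := by
    rintro a b ⟨ha, ha'⟩ ⟨hb, hb'⟩
    refine ⟨fun s hs => by simp [ha s hs, hb s hs], fun j hj => ?_⟩
    simp [add_mul, Finset.sum_add_distrib, ha' j hj, hb' j hj]
  smul_mem' := by
    rintro c a ⟨ha, ha'⟩
    refine ⟨fun s hs => by simp [ha s hs], fun j hj => ?_⟩
    simp [mul_assoc, ← Finset.mul_sum, ha' j hj]

/-- The linear dependencies between the columns of `V` with index in `B`, modulo the first `r`
unit vectors. -/
def dependencies (V : Matrix (Fin k) (Fin n) R) (B : Finset (Fin n)) (r : ℕ) :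
    Submodule R (Fin n → R) where
  carrier := {c | (∀ j ∉ B, c j = 0) ∧ ∀ s : Fin k, r ≤ s.val → ∑ j, c j * V s j = 0}
  zero_mem' := by simp
  add_mem' := by
    rintro a b ⟨ha, ha'⟩ ⟨hb, hb'⟩
    refine ⟨fun s hs => by simp [ha s hs, hb s hs], fun j hj => ?_⟩
    simp [add_mul, Finset.sum_add_distrib, ha' j hj, hb' j hj]
  smul_mem' := by
    rintro c a ⟨ha, ha'⟩
    refine ⟨fun s hs => by simp [ha s hs], fun j hj => ?_⟩
    simp [mul_assoc, ← Finset.mul_sum, ha' j hj]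

theorem mem_annihilator {V : Matrix (Fin k) (Fin n) R} {A : Finset (Fin n)} {r : ℕ}
    {g : Fin k → R} : g ∈ annihilator V A r ↔
      (∀ s : Fin k, s.val < r → g s = 0) ∧ ∀ j ∈ A, ∑ s, g s * V s j = 0 := Iff.rfl

theorem annihilator_mono (V : Matrix (Fin k) (Fin n) R) {A A' : Finset (Fin n)} {r r' : ℕ}
    (hA : A' ⊆ A) (hr : r' ≤ r) : annihilator V A r ≤ annihilator V A' r' :=
  fun _ hg => ⟨fun s hs => hg.1 s (hs.trans_le hr), fun j hj => hg.2 j (hA hj)⟩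

theorem dependencies_mono (V : Matrix (Fin k) (Fin n) R) {B B' : Finset (Fin n)} {r r' : ℕ}
    (hB : B ⊆ B') (hr : r ≤ r') : dependencies V B r ≤ dependencies V B' r' :=
  fun _ hc => ⟨fun j hj => hc.1 j fun h => hj (hB h), fun s hs => hc.2 s (hr.trans hs)⟩

end

section

variable {F : Type*} [Field F] {d k n : ℕ} {f : Fin k → MvPowerSeries (Fin d) F}

/-- As `z_j` tends to the origin, the condition of being orthogonal to the `j`-th column becomes
orthogonality to the next unit vector. -/
theorem exists_annihilator_degeneration (hf0 : ∀ s, f s ≠ 0)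
    (hf : StrictMono fun s => MvPowerSeries.lexOrder (f s)) (j : Fin n) {ι : Type*} (S : Finset ι)
    {A : ι → Finset (Fin n)} {r : ι → ℕ}
    {g : ι → Fin k → MvPowerSeries (Fin n × Fin d) F}
    (hg : ∀ i ∈ S, g i ∈ annihilator (evalMatrix f n) (A i) (r i)) (hne : ∃ i ∈ S, g i ≠ 0) :
    ∃ g' : ι → Fin k → MvPowerSeries (Fin n × Fin d) F,
      (∑ i ∈ S, g i = 0 → ∑ i ∈ S, g' i = 0) ∧ (∃ i ∈ S, g' i ≠ 0) ∧
      ∀ i ∈ S, g' i ∈ annihilator (evalMatrix f n) ((A i).erase j)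
        (if j ∈ A i then r i + 1 else r i) := by
  obtain ⟨i₀, hi₀, hne⟩ := hne
  obtain ⟨s₀, hs₀⟩ := Function.ne_iff.1 hne
  obtain ⟨Y, L, hY, ⟨⟨i₁, s₁⟩, hL⟩, -, hLmul, hrel⟩ := exists_leadingCoeff hf0 hf j
    (N := S × Fin k) (fun ν => g ν.1 ν.2) ⟨⟨⟨i₀, hi₀⟩, s₀⟩, hs₀⟩
  refine ⟨fun i s => L (g i s), fun h => ?_, ⟨i₁, i₁.2, fun h => hL (congrFun h s₁)⟩,
    fun i hi => ⟨fun s hs => ?_, fun j' hj' => ?_⟩⟩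
  · ext1 s
    have := congrFun h s
    rw [Finset.sum_apply] at this ⊢
    rw [← map_sum, this]
    exact map_zero L
  · have hlt : s.val < r i → L (g i s) = 0 := fun h => by rw [(hg i hi).1 s h, map_zero]
    split_ifs at hs with hj
    · rcases Nat.lt_succ_iff_lt_or_eq.1 hs with h | h
      · exact hlt h
      · refine hrel (g i) s (fun t => hY (⟨i, hi⟩, t)) (fun t ht => (hg i hi).1 t ?_)
          ((hg i hi).2 j hj)
        rw [← h]
        exact ht
    · exact hlt hs
  · rw [Finset.mem_erase] at hj'
    simp_rw [← hLmul _ j' hj'.1]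
    rw [← map_sum, (hg i hi).2 j' hj'.2, map_zero]

/-- As `z_j` tends to the origin, the `j`-th column becomes the next unit vector. Once all unit
vectors are used up, the coefficient of the `j`-th column is lost; since the sum of all the
dependencies vanishes, this does no harm if it happens for one of them only. -/
theorem exists_dependencies_degeneration (hf0 : ∀ s, f s ≠ 0)
    (hf : StrictMono fun s => MvPowerSeries.lexOrder (f s)) (j : Fin n) {ι : Type*} (S : Finset ι)
    {B : ι → Finset (Fin n)} {r : ι → ℕ}
    (huniq : ∀ i ∈ S, ∀ i' ∈ S, j ∈ B i → j ∈ B i' → k ≤ r i → k ≤ r i' → i = i')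
    {c : ι → Fin n → MvPowerSeries (Fin n × Fin d) F}
    (hc : ∀ i ∈ S, c i ∈ dependencies (evalMatrix f n) (B i) (r i)) (hne : ∃ i ∈ S, c i ≠ 0)
    (hsum : ∑ i ∈ S, c i = 0) :
    ∃ c' : ι → Fin n → MvPowerSeries (Fin n × Fin d) F,
      ∑ i ∈ S, c' i = 0 ∧ (∃ i ∈ S, c' i ≠ 0) ∧
      ∀ i ∈ S, c' i ∈ dependencies (evalMatrix f n) ((B i).erase j)
        (if j ∈ B i then min (r i + 1) k else r i) := by
  classical
  have hp : ∀ s, evalMatrix f n s j ≠ 0 := by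
    intro s h
    let e : Fin d ↪ Fin n × Fin d := ⟨fun t => (j, t), fun a b hab => (Prod.ext_iff.1 hab).2⟩
    exact hf0 s (MvPowerSeries.rename_injective e (h.trans (map_zero _).symm))
  have hcol : ∀ j', ∑ i ∈ S, c i j' = 0 := fun j' => by
    have := congrFun hsum j'
    rwa [Finset.sum_apply] at this
  have hx : ∃ ν : S × {j' : Fin n // j' ≠ j}, c ν.1 ν.2 ≠ 0 := by
    by_contra! hzero
    replace hzero : ∀ i ∈ S, ∀ j' ≠ j, c i j' = 0 := fun i hi j' hj' =>
      hzero (⟨i, hi⟩, ⟨j', hj'⟩)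
    have hj : ∀ i ∈ S, c i j ≠ 0 → j ∈ B i ∧ k ≤ r i := by
      intro i hi hij
      refine ⟨by_contra fun h => hij ((hc i hi).1 j h), not_lt.1 fun hlt => hij ?_⟩
      have := (hc i hi).2 ⟨r i, hlt⟩ le_rfl
      rw [Finset.sum_eq_single j (fun j' _ hj' => by rw [hzero i hi j' hj', zero_mul])
        (by simp)] at this
      exact (mul_eq_zero.1 this).resolve_right (hp _)
    obtain ⟨i, hi, hci⟩ := hne
    have hij : c i j ≠ 0 := by
      intro h
      apply hci
      ext1 j'
      by_cases hj' : j' = j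
      · rw [hj', h]
        rfl
      · exact hzero i hi j' hj'
    have := hcol j
    rw [Finset.sum_eq_single i (fun i' hi' hne => by_contra fun h => hne (huniq i' hi' i hi
      (hj i' hi' h).1 (hj i hi hij).1 (hj i' hi' h).2 (hj i hi hij).2)) (fun h => absurd hi h)]
      at this
    exact hij this
  obtain ⟨Y, L, hY, ⟨⟨i₁, j₁⟩, hL⟩, hYmul, hLmul, hrel⟩ := exists_leadingCoeff hf0 hf j
    (N := S × {j' : Fin n // j' ≠ j}) (fun ν => c ν.1 ν.2) hx
  replace hY : ∀ i ∈ S, ∀ j' ≠ j, c i j' ∈ Y := fun i hi j' hj' => hY (⟨i, hi⟩, ⟨j', hj'⟩)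
  refine ⟨fun i j' => if j' = j then 0 else L (c i j'), ?_, ⟨i₁, i₁.2, fun h => hL ?_⟩,
    fun i hi => ⟨fun j' hj' => ?_, fun s hs => ?_⟩⟩
  · ext1 j'
    rw [Finset.sum_apply]
    by_cases hj' : j' = j
    · simp [hj']
    · simp only [if_neg hj']
      rw [← map_sum, hcol, map_zero]
      rfl
  · have := congrFun h j₁
    exact (if_neg j₁.2).symm.trans this
  · dsimp only
    split_ifs with h
    · rfl
    · rw [(hc i hi).1 j' fun h' => hj' (Finset.mem_erase.2 ⟨h, h'⟩), map_zero]
  · -- the contribution of the columns other than the `j`-th one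
    let D : Fin k → MvPowerSeries (Fin n × Fin d) F := fun t =>
      ∑ j' ∈ Finset.univ.erase j, c i j' * evalMatrix f n t j'
    have hD : ∀ t, r i ≤ t.val → D t + c i j * evalMatrix f n t j = 0 := fun t ht => by
      rw [← (hc i hi).2 t ht]
      exact Finset.sum_erase_add _ _ (Finset.mem_univ j)
    have hDY : ∀ t, D t ∈ Y := fun t => Y.sum_mem fun j' hj' =>
      hYmul _ (hY i hi j' (Finset.ne_of_mem_erase hj')) j' (Finset.ne_of_mem_erase hj') t
    have hLD : ∑ j', (if j' = j then 0 else L (c i j')) * evalMatrix f n s j' = L (D s) := by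
      rw [← Finset.sum_erase_add _ _ (Finset.mem_univ j), if_pos rfl, zero_mul, add_zero, map_sum]
      refine Finset.sum_congr rfl fun j' hj' => ?_
      rw [if_neg (Finset.ne_of_mem_erase hj'), hLmul _ j' (Finset.ne_of_mem_erase hj')]
    rw [hLD]
    split_ifs at hs with hj
    · have hrs : r i + 1 ≤ s.val := by
        have := s.2
        omega
      let t : Fin k := ⟨r i, by have := s.2; omega⟩
      have hts : t < s := hrs
      have hst : s ≠ t := hts.ne'
      have := hrel (Pi.single t (D s) - Pi.single s (D t)) t ?_ ?_ ?_
      · simpa [Pi.single_apply, hst.symm] using this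
      · intro u
        rw [Pi.sub_apply, Pi.single_apply, Pi.single_apply]
        refine Y.sub_mem ?_ ?_ <;> split_ifs <;> first | exact hDY _ | exact Y.zero_mem
      · intro u hu
        simp [hu.ne, (hu.trans hts).ne]
      · simp only [Pi.sub_apply, sub_mul, Finset.sum_sub_distrib, Pi.single_apply, ite_mul,
          zero_mul, Finset.sum_ite_eq', Finset.mem_univ, if_true]
        linear_combination evalMatrix f n t j * hD s (by omega) - evalMatrix f n s j * hD t le_rfl
    · have h := hD s hs
      rw [(hc i hi).1 j hj, zero_mul, add_zero] at h
      rw [h, map_zero]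

theorem annihilator_eq_bot (hf0 : ∀ s, f s ≠ 0)
    (hf : StrictMono fun s => MvPowerSeries.lexOrder (f s)) (A : Finset (Fin n)) (r : ℕ)
    (h : k ≤ A.card + r) : annihilator (evalMatrix f n) A r = ⊥ := by
  induction A using Finset.strongInduction generalizing r with
  | H A ih =>
    rw [Submodule.eq_bot_iff]
    intro g hg
    by_cases hrk : k ≤ r
    · ext1 s
      exact hg.1 s (s.2.trans_le hrk)
    · obtain ⟨j, hj⟩ : A.Nonempty := Finset.card_pos.1 (by omega)
      by_contra hne
      obtain ⟨g', -, ⟨_, -, hne'⟩, hg'⟩ := exists_annihilator_degeneration hf0 hf j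
        (Finset.univ : Finset Unit) (A := fun _ => A) (r := fun _ => r)
        (g := fun _ => g) (fun _ _ => hg) ⟨(), by simp, hne⟩
      have := hg' () (by simp)
      rw [if_pos hj, ih _ (Finset.erase_ssubset hj) (r + 1)
        (by rw [Finset.card_erase_of_mem hj]; omega), Submodule.mem_bot] at this
      exact hne' this

theorem dependencies_eq_bot (hf0 : ∀ s, f s ≠ 0)
    (hf : StrictMono fun s => MvPowerSeries.lexOrder (f s)) (B : Finset (Fin n)) (r : ℕ)
    (h : B.card + r ≤ k) : dependencies (evalMatrix f n) B r = ⊥ := by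
  induction B using Finset.strongInduction generalizing r with
  | H B ih =>
    rw [Submodule.eq_bot_iff]
    intro c hc
    obtain rfl | ⟨j, hj⟩ := B.eq_empty_or_nonempty
    · ext1 j
      exact hc.1 j (Finset.notMem_empty j)
    · have hcard := Finset.card_pos.2 ⟨j, hj⟩
      by_contra hne
      -- the degeneration is applied to the trivial relation `c + (-c) = 0`
      obtain ⟨c', -, ⟨i, -, hne'⟩, hc'⟩ := exists_dependencies_degeneration hf0 hf j
        (Finset.univ : Finset Bool) (B := fun _ => B) (r := fun _ => r)
        (fun _ _ _ _ _ _ _ _ => by omega) (c := fun b => if b then c else -c)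
        (fun b _ => by cases b <;> simpa using hc) ⟨true, by simpa using hne⟩ (by simp)
      have := hc' i (by simp)
      rw [if_pos hj, ih _ (Finset.erase_ssubset hj) (min (r + 1) k)
        (by rw [Finset.card_erase_of_mem hj]; omega), Submodule.mem_bot] at this
      exact hne' this

end

/-! ### Independence of the annihilators -/

section

variable {ι R E : Type*} [Semiring R] [AddCommMonoid E] [Module R E]

theorem IndepOn.of_card_le_one {S : Finset ι} (X : ι → Submodule R E) (h : S.card ≤ 1) :
    IndepOn S X := by
  intro g _ hsum i hi
  rwa [Finset.sum_eq_single i (fun i' hi' hne => absurd (Finset.card_le_one.1 h i' hi' i hi) hne)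
    (fun h => absurd hi h)] at hsum

variable [DecidableEq ι]

theorem IndepOn.of_erase {S : Finset ι} {X : ι → Submodule R E} {i : ι} (hi : i ∈ S)
    (hX : X i = ⊥) (h : IndepOn (S.erase i) X) : IndepOn S X := by
  intro g hg hsum
  have hgi : g i = 0 := by
    have := hg i hi
    rwa [hX, Submodule.mem_bot] at this
  rw [← Finset.add_sum_erase S g hi, hgi, zero_add] at hsum
  have := h g (fun i' hi' => hg i' (Finset.mem_of_mem_erase hi')) hsum
  intro i' hi'
  by_cases hii : i' = i
  · rw [hii, hgi]
  · exact this i' (Finset.mem_erase.2 ⟨hii, hi'⟩)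

/-- Independence can be checked after some of the submodules, independent among themselves, are
replaced by a single one that contains them. -/
theorem IndepOn.of_replace {S I : Finset ι} {X X' : ι → Submodule R E} {i₀ : ι} (hIS : I ⊆ S)
    (hi₀ : i₀ ∈ I) (hX : ∀ i ∈ S \ I, X i ≤ X' i) (hXI : ∀ i ∈ I, X i ≤ X' i₀)
    (hI : IndepOn I X) (h : IndepOn (insert i₀ (S \ I)) X') : IndepOn S X := by
  intro g hg hsum
  have hi₀' : i₀ ∉ S \ I := fun h => (Finset.mem_sdiff.1 h).2 hi₀
  have hne : ∀ i ∈ S \ I, i ≠ i₀ := fun i hi h => hi₀' (h ▸ hi)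
  have key := h (Function.update g i₀ (∑ i ∈ I, g i)) ?_ ?_
  · have hsumI : ∑ i ∈ I, g i = 0 := by
      simpa using key i₀ (Finset.mem_insert_self _ _)
    intro i hi
    by_cases hiI : i ∈ I
    · exact hI g (fun i hi => hg i (hIS hi)) hsumI i hiI
    · have hi' := Finset.mem_sdiff.2 ⟨hi, hiI⟩
      simpa [hne i hi'] using key i (Finset.mem_insert_of_mem hi')
  · intro i hi
    rcases Finset.mem_insert.1 hi with rfl | hi
    · rw [Function.update_self]
      exact Submodule.sum_mem _ fun i hi => hXI i hi (hg i (hIS hi))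
    · rw [Function.update_of_ne (hne i hi)]
      exact hX i hi (hg i (Finset.mem_sdiff.1 hi).1)
  · rw [Finset.sum_insert hi₀', Function.update_self, Finset.sum_congr rfl
      (fun i hi => Function.update_of_ne (hne i hi) _ _), add_comm, Finset.sum_sdiff hIS, hsum]

end

section

variable {F : Type*} [Field F] {d k n : ℕ} {f : Fin k → MvPowerSeries (Fin d) F}

/-- The dimension count which is necessary for the independence of the annihilators of `A i` and
`r i` unit vectors, for columns in general position: for every subfamily, the sum of the dimensions
is at most that of the annihilator of the common part, and hence of any subset `T` of
the common part together with `ρ` common unit vectors. -/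
def AnnihilatorCondition {ι : Type*} (k : ℕ) (S : Finset ι) (A : ι → Finset (Fin n))
    (r : ι → ℕ) : Prop :=
  ∀ I ⊆ S, I.Nonempty → ∀ (T : Finset (Fin n)) (ρ : ℕ), (∀ i ∈ I, T ⊆ A i) → (∀ i ∈ I, ρ ≤ r i) →
    T.card + ρ + ∑ i ∈ I, (k - ((A i).card + r i)) ≤ k

variable {ι : Type*} [DecidableEq ι]

theorem AnnihilatorCondition.replace {S I : Finset ι} {A : ι → Finset (Fin n)} {r : ι → ℕ}
    (h : AnnihilatorCondition k S A r) (hIS : I ⊆ S) {i₀ : ι} (hi₀ : i₀ ∈ I)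
    {T : Finset (Fin n)} {ρ : ℕ} (hT : ∀ i ∈ I, T ⊆ A i) (hρ : ∀ i ∈ I, ρ ≤ r i)
    (htight : T.card + ρ + ∑ i ∈ I, (k - ((A i).card + r i)) = k) :
    AnnihilatorCondition k (insert i₀ (S \ I)) (Function.update A i₀ T)
      (Function.update r i₀ ρ) := by
  intro J hJ hJne T' ρ' hT' hρ'
  have hJ0 : J.erase i₀ ⊆ S \ I := by
    intro i hi
    rw [Finset.mem_erase] at hi
    exact (Finset.mem_insert.1 (hJ hi.2)).resolve_left hi.1
  have hsumJ : ∑ i ∈ J.erase i₀, (k - ((Function.update A i₀ T i).card +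
      Function.update r i₀ ρ i)) = ∑ i ∈ J.erase i₀, (k - ((A i).card + r i)) := by
    refine Finset.sum_congr rfl fun i hi => ?_
    rw [Function.update_of_ne (Finset.ne_of_mem_erase hi),
      Function.update_of_ne (Finset.ne_of_mem_erase hi)]
  have hA : ∀ i ∈ J.erase i₀, T' ⊆ A i := fun i hi => by
    have := hT' i (Finset.mem_of_mem_erase hi)
    rwa [Function.update_of_ne (Finset.ne_of_mem_erase hi)] at this
  have hr : ∀ i ∈ J.erase i₀, ρ' ≤ r i := fun i hi => by
    have := hρ' i (Finset.mem_of_mem_erase hi)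
    rwa [Function.update_of_ne (Finset.ne_of_mem_erase hi)] at this
  by_cases hi₀J : i₀ ∈ J
  · have hT₀ := hT' i₀ hi₀J
    have hρ₀ := hρ' i₀ hi₀J
    rw [Function.update_self] at hT₀ hρ₀
    have := h (I ∪ J.erase i₀) (Finset.union_subset hIS (hJ0.trans Finset.sdiff_subset))
      ⟨i₀, Finset.mem_union_left _ hi₀⟩ T' ρ'
      (fun i hi => (Finset.mem_union.1 hi).elim (fun hi => hT₀.trans (hT i hi)) (hA i))
      (fun i hi => (Finset.mem_union.1 hi).elim (fun hi => hρ₀.trans (hρ i hi)) (hr i))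
    rw [Finset.sum_union (Finset.disjoint_of_subset_right hJ0 Finset.disjoint_sdiff)] at this
    rw [← Finset.add_sum_erase J _ hi₀J, hsumJ, Function.update_self, Function.update_self]
    omega
  · rw [Finset.erase_eq_of_notMem hi₀J] at hJ0 hsumJ hA hr
    rw [hsumJ]
    exact h J (hJ0.trans Finset.sdiff_subset) hJne T' ρ' hA hr

/-- If no proper subfamily is tight, then the condition is preserved when `z_j` tends to the
origin, unless `j` belongs to all `A i` with the smallest number of unit vectors, but not to all
`A i`. -/
theorem AnnihilatorCondition.degenerate {S : Finset ι} {A : ι → Finset (Fin n)} {r : ι → ℕ}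
    (h : AnnihilatorCondition k S A r) (hlt : ∀ i ∈ S, (A i).card + r i < k)
    (hslack : ∀ I ⊆ S, 2 ≤ I.card → I ≠ S → ∀ (T : Finset (Fin n)) (ρ : ℕ), (∀ i ∈ I, T ⊆ A i) →
      (∀ i ∈ I, ρ ≤ r i) → T.card + ρ + ∑ i ∈ I, (k - ((A i).card + r i)) < k)
    {j : Fin n} (hj : (∃ i ∈ S, j ∉ A i ∧ ∀ i' ∈ S, r i ≤ r i') ∨ ∀ i ∈ S, j ∈ A i) :
    AnnihilatorCondition k S (fun i => (A i).erase j)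
      (fun i => if j ∈ A i then r i + 1 else r i) := by
  have hcard : ∀ i, ((A i).erase j).card + (if j ∈ A i then r i + 1 else r i) =
      (A i).card + r i := by
    intro i
    split_ifs with h
    · rw [← Finset.card_erase_add_one h]
      omega
    · rw [Finset.erase_eq_of_notMem h]
  intro J hJ hJne T ρ hT hρ
  simp only [hcard]
  have hTA : ∀ i ∈ J, T ⊆ A i := fun i hi => (hT i hi).trans (Finset.erase_subset _ _)
  have hρr : ∀ i ∈ J, ρ - 1 ≤ r i := fun i hi => by
    have := hρ i hi
    dsimp only at this
    split_ifs at this <;> omega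
  by_cases hJ1 : J.card ≤ 1
  · obtain ⟨i, rfl⟩ := Finset.card_eq_one.1 (le_antisymm hJ1 hJne.card_pos)
    have h1 := Finset.card_le_card (hT i (Finset.mem_singleton_self i))
    have h2 := hρ i (Finset.mem_singleton_self i)
    have h3 := hcard i
    have h4 := hlt i (hJ (Finset.mem_singleton_self i))
    dsimp only at h1 h2
    rw [Finset.sum_singleton]
    omega
  · by_cases hJS : J = S
    · subst hJS
      rcases hj with ⟨i₀, hi₀, hji₀, hmin⟩ | hj
      · refine h J hJ hJne T ρ hTA fun i hi => ?_
        have := (hρ i₀ hi₀).trans_eq (if_neg hji₀)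
        exact this.trans (hmin i hi)
      · obtain ⟨i₀, hi₀⟩ := hJne
        have hjT : j ∉ T := fun h => by simpa using hT i₀ hi₀ h
        have := h J hJ ⟨i₀, hi₀⟩ (insert j T) (ρ - 1)
          (fun i hi => Finset.insert_subset (hj i hi) (hTA i hi)) hρr
        rw [Finset.card_insert_of_notMem hjT] at this
        omega
    · have := hslack J hJ (by omega) hJS T (ρ - 1) hTA hρr
      omega

/-- The annihilators are independent as soon as the necessary dimension counts hold. The induction
is on the number `m` of annihilators and, for fixed `m`, on the number `M` of unit vectors which can
still be added. -/
theorem indepOn_annihilator (hf0 : ∀ s, f s ≠ 0)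
    (hf : StrictMono fun s => MvPowerSeries.lexOrder (f s)) (m : ℕ) :
    ∀ (M : ℕ) (S : Finset ι) (A : ι → Finset (Fin n)) (r : ι → ℕ), S.card = m →
      ∑ i ∈ S, (k - r i) = M → (∀ i ∈ S, (A i).card + r i ≤ k) → AnnihilatorCondition k S A r →
      IndepOn S fun i => annihilator (evalMatrix f n) (A i) (r i) := by
  induction m using Nat.strong_induction_on with
  | _ m ihm =>
  intro M
  induction M using Nat.strong_induction_on with
  | _ M ihM =>
  intro S A r hm hM hle h
  -- a zero space can be dropped
  by_cases h0 : ∃ i ∈ S, k ≤ (A i).card + r i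
  · obtain ⟨i, hi, hk⟩ := h0
    refine IndepOn.of_erase hi (annihilator_eq_bot hf0 hf _ _ hk) ?_
    exact ihm _ (hm ▸ Finset.card_erase_lt_of_mem hi) _ _ A r rfl rfl
      (fun i hi => hle i (Finset.mem_of_mem_erase hi))
      fun I hI => h I (hI.trans (Finset.erase_subset _ _))
  push Not at h0
  -- a tight subfamily can be replaced by the annihilator of its common part
  by_cases htight : ∃ I ⊆ S, 2 ≤ I.card ∧ I ≠ S ∧ ∃ (T : Finset (Fin n)) (ρ : ℕ),
      (∀ i ∈ I, T ⊆ A i) ∧ (∀ i ∈ I, ρ ≤ r i) ∧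
      T.card + ρ + ∑ i ∈ I, (k - ((A i).card + r i)) = k
  · obtain ⟨I, hIS, hI2, hIne, T, ρ, hT, hρ, htight⟩ := htight
    have hIlt : I.card < S.card := Finset.card_lt_card (hIS.ssubset_of_ne hIne)
    obtain ⟨i₀, hi₀⟩ : I.Nonempty := Finset.card_pos.1 (by omega)
    have hi₀' : i₀ ∉ S \ I := fun h => (Finset.mem_sdiff.1 h).2 hi₀
    have hne : ∀ i ∈ S \ I, i ≠ i₀ := fun i hi h => hi₀' (h ▸ hi)
    refine IndepOn.of_replace (X' := fun i => annihilator (evalMatrix f n)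
      (Function.update A i₀ T i) (Function.update r i₀ ρ i)) hIS hi₀ ?_ ?_ ?_ ?_
    · intro i hi
      simp only [Function.update_of_ne (hne i hi), le_refl]
    · intro i hi
      simp only [Function.update_self]
      exact annihilator_mono _ (hT i hi) (hρ i hi)
    · exact ihm _ (hm ▸ hIlt) _ I A r rfl rfl (fun i hi => hle i (hIS hi))
        fun J hJ => h J (hJ.trans hIS)
    · refine ihm _ ?_ _ _ _ _ rfl rfl ?_ (h.replace hIS hi₀ hT hρ htight)
      · rw [Finset.card_insert_of_notMem hi₀', Finset.card_sdiff_of_subset hIS]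
        omega
      · intro i hi
        rcases Finset.mem_insert.1 hi with rfl | hi
        · simp only [Function.update_self]
          omega
        · simp only [Function.update_of_ne (hne i hi)]
          exact hle i (Finset.mem_sdiff.1 hi).1
  have hslack : ∀ I ⊆ S, 2 ≤ I.card → I ≠ S → ∀ (T : Finset (Fin n)) (ρ : ℕ),
      (∀ i ∈ I, T ⊆ A i) → (∀ i ∈ I, ρ ≤ r i) →
      T.card + ρ + ∑ i ∈ I, (k - ((A i).card + r i)) < k := by
    intro I hI hI2 hIne T ρ hT hρ
    exact lt_of_le_of_ne (h I hI (Finset.card_pos.1 (by omega)) T ρ hT hρ) fun heq =>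
      htight ⟨I, hI, hI2, hIne, T, ρ, hT, hρ, heq⟩
  by_cases hS : S.card ≤ 1
  · exact IndepOn.of_card_le_one _ hS
  obtain ⟨i₀, hi₀, hmin⟩ := S.exists_min_image r (Finset.card_pos.1 (by omega))
  -- if possible, one of the points is moved to the origin
  by_cases hdeg : ∃ j, (∃ i ∈ S, j ∈ A i) ∧
      ((∃ i ∈ S, j ∉ A i ∧ ∀ i' ∈ S, r i ≤ r i') ∨ ∀ i ∈ S, j ∈ A i)
  · obtain ⟨j, ⟨i₁, hi₁, hj₁⟩, hj⟩ := hdeg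
    have hind := ihM (∑ i ∈ S, (k - if j ∈ A i then r i + 1 else r i)) ?_ S
      (fun i => (A i).erase j) (fun i => if j ∈ A i then r i + 1 else r i) hm rfl ?_
      (h.degenerate h0 hslack hj)
    · intro g hg hsum
      by_contra! hne
      obtain ⟨g', hsum', ⟨i, hi, hne'⟩, hg'⟩ := exists_annihilator_degeneration hf0 hf j S hg hne
      exact hne' (hind g' hg' (hsum' hsum) i hi)
    · rw [← hM]
      refine Finset.sum_lt_sum (fun i _ => by split_ifs <;> omega) ⟨i₁, hi₁, ?_⟩
      have := h0 i₁ hi₁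
      rw [if_pos hj₁]
      omega
    · intro i hi
      have := h0 i hi
      split_ifs with hji
      · have := Finset.card_erase_add_one hji
        omega
      · rw [Finset.erase_eq_of_notMem hji]
        omega
  push Not at hdeg
  -- now `A i₀` contains all the other sets, and `i₀` is the only index with the smallest `r`
  have hmem : ∀ i ∈ S, (∀ i' ∈ S, r i ≤ r i') → ∀ i' ∈ S, A i' ⊆ A i := by
    intro i hi hmini i' hi' j hj
    by_contra hji
    obtain ⟨i'', hi'', hlt⟩ := (hdeg j ⟨i', hi', hj⟩).1 i hi hji
    exact absurd (hmini i'' hi'') (not_le.2 hlt)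
  have hlt : ∀ i ∈ S, i ≠ i₀ → r i₀ + 1 ≤ r i := by
    intro i hi hne
    by_contra! hri
    have hri : r i = r i₀ := le_antisymm (by omega) (hmin i hi)
    have hAi : A i = A i₀ := (hmem i₀ hi₀ hmin i hi).antisymm
      (hmem i hi (fun i' hi' => hri ▸ hmin i' hi') i₀ hi₀)
    have := h {i₀, i} (by simp [Finset.insert_subset_iff, hi₀, hi]) (by simp) (A i₀) (r i₀)
      (by simp [hAi]) (by simp [hri])
    rw [Finset.sum_pair hne.symm, hAi, hri] at this
    have := h0 i₀ hi₀
    omega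
  -- all the other spaces lie in the hyperplane where the coordinate `r i₀` vanishes, so adding a
  -- unit vector to the `i₀`-th condition loses no relation
  have hind := ihM (∑ i ∈ S, (k - Function.update r i₀ (r i₀ + 1) i)) ?_ S A
    (Function.update r i₀ (r i₀ + 1)) hm rfl ?_ ?_
  · intro g hg hsum
    refine hind g (fun i hi => ?_) hsum
    dsimp only
    by_cases hii : i = i₀
    · subst hii
      rw [Function.update_self]
      refine ⟨fun s hs => ?_, (hg i hi).2⟩
      rcases Nat.lt_succ_iff_lt_or_eq.1 hs with hs | hs
      · exact (hg i hi).1 s hs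
      · have := congrFun hsum s
        rwa [Finset.sum_apply, Finset.sum_eq_single i (fun i' hi' hne =>
          (hg i' hi').1 s (hs ▸ hlt i' hi' hne)) (fun h => absurd hi h)] at this
    · rw [Function.update_of_ne hii]
      exact hg i hi
  · rw [← hM]
    refine Finset.sum_lt_sum (fun i _ => ?_) ⟨i₀, hi₀, ?_⟩
    · by_cases hii : i = i₀
      · subst hii
        rw [Function.update_self]
        omega
      · rw [Function.update_of_ne hii]
    · have := h0 i₀ hi₀
      rw [Function.update_self]
      omega
  · intro i hi
    have := h0 i hi
    by_cases hii : i = i₀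
    · subst hii
      rw [Function.update_self]
      omega
    · rw [Function.update_of_ne hii]
      omega
  · intro J hJ hJne T ρ hT hρ
    by_cases hJ₀ : i₀ ∈ J
    · have hρ₀ := hρ i₀ hJ₀
      rw [Function.update_self] at hρ₀
      have key := h J hJ hJne T (ρ - 1) hT fun i hi => by
        have := hmin i (hJ hi)
        omega
      have hsum : ∑ i ∈ J.erase i₀, (k - ((A i).card + Function.update r i₀ (r i₀ + 1) i)) =
          ∑ i ∈ J.erase i₀, (k - ((A i).card + r i)) :=
        Finset.sum_congr rfl fun i hi => by rw [Function.update_of_ne (Finset.ne_of_mem_erase hi)]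
      have := h0 i₀ hi₀
      rw [← Finset.add_sum_erase J _ hJ₀] at key ⊢
      rw [hsum, Function.update_self]
      omega
    · have hne : ∀ i ∈ J, i ≠ i₀ := fun i hi h => hJ₀ (h ▸ hi)
      rw [Finset.sum_congr rfl fun i hi => by rw [Function.update_of_ne (hne i hi)]]
      refine h J hJ hJne T ρ hT fun i hi => ?_
      have := hρ i hi
      rwa [Function.update_of_ne (hne i hi)] at this

end

/-! ### Independence of the dependencies -/

section

variable {F : Type*} [Field F] {d k n : ℕ} {f : Fin k → MvPowerSeries (Fin d) F}

/-- The dimension count which is necessary for the independence of the spaces of dependencies among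
the columns in `B i` and `r i` unit vectors, for columns in general position: for every subfamily,
the sum of the dimensions is at most the dimension of the space of dependencies among the union,
and hence among any superset `T` of the union together with at least as many unit vectors. -/
def DependencyCondition {ι : Type*} (k : ℕ) (S : Finset ι) (B : ι → Finset (Fin n))
    (r : ι → ℕ) : Prop :=
  ∀ I ⊆ S, I.Nonempty → ∀ (T : Finset (Fin n)) (ρ : ℕ), ρ ≤ k → (∀ i ∈ I, B i ⊆ T) →
    (∀ i ∈ I, r i ≤ ρ) → ∑ i ∈ I, ((B i).card + r i - k) + k ≤ T.card + ρ

variable {ι : Type*} [DecidableEq ι]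

theorem DependencyCondition.replace {S I : Finset ι} {B : ι → Finset (Fin n)} {r : ι → ℕ}
    (h : DependencyCondition k S B r) (hIS : I ⊆ S) {i₀ : ι} (hi₀ : i₀ ∈ I)
    {T : Finset (Fin n)} {ρ : ℕ} (hT : ∀ i ∈ I, B i ⊆ T) (hρ : ∀ i ∈ I, r i ≤ ρ)
    (htight : ∑ i ∈ I, ((B i).card + r i - k) + k = T.card + ρ) :
    DependencyCondition k (insert i₀ (S \ I)) (Function.update B i₀ T)
      (Function.update r i₀ ρ) := by
  intro J hJ hJne T' ρ' hρk hT' hρ'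
  have hJ0 : J.erase i₀ ⊆ S \ I := by
    intro i hi
    rw [Finset.mem_erase] at hi
    exact (Finset.mem_insert.1 (hJ hi.2)).resolve_left hi.1
  have hsumJ : ∑ i ∈ J.erase i₀, ((Function.update B i₀ T i).card +
      Function.update r i₀ ρ i - k) = ∑ i ∈ J.erase i₀, ((B i).card + r i - k) := by
    refine Finset.sum_congr rfl fun i hi => ?_
    rw [Function.update_of_ne (Finset.ne_of_mem_erase hi),
      Function.update_of_ne (Finset.ne_of_mem_erase hi)]
  have hB : ∀ i ∈ J.erase i₀, B i ⊆ T' := fun i hi => by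
    have := hT' i (Finset.mem_of_mem_erase hi)
    rwa [Function.update_of_ne (Finset.ne_of_mem_erase hi)] at this
  have hr : ∀ i ∈ J.erase i₀, r i ≤ ρ' := fun i hi => by
    have := hρ' i (Finset.mem_of_mem_erase hi)
    rwa [Function.update_of_ne (Finset.ne_of_mem_erase hi)] at this
  by_cases hi₀J : i₀ ∈ J
  · have hT₀ := hT' i₀ hi₀J
    have hρ₀ := hρ' i₀ hi₀J
    rw [Function.update_self] at hT₀ hρ₀
    have := h (I ∪ J.erase i₀) (Finset.union_subset hIS (hJ0.trans Finset.sdiff_subset))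
      ⟨i₀, Finset.mem_union_left _ hi₀⟩ T' ρ' hρk
      (fun i hi => (Finset.mem_union.1 hi).elim (fun hi => (hT i hi).trans hT₀) (hB i))
      (fun i hi => (Finset.mem_union.1 hi).elim (fun hi => (hρ i hi).trans hρ₀) (hr i))
    rw [Finset.sum_union (Finset.disjoint_of_subset_right hJ0 Finset.disjoint_sdiff)] at this
    rw [← Finset.add_sum_erase J _ hi₀J, hsumJ, Function.update_self, Function.update_self]
    omega
  · rw [Finset.erase_eq_of_notMem hi₀J] at hJ0 hsumJ hB hr
    rw [hsumJ]
    exact h J (hJ0.trans Finset.sdiff_subset) hJne T' ρ' hρk hB hr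

/-- If no proper subfamily is tight, then the condition is preserved when `z_j` tends to the
origin, for any `j` in a set `B i₀` with the largest number of unit vectors. -/
theorem DependencyCondition.degenerate {S : Finset ι} {B : ι → Finset (Fin n)} {r : ι → ℕ}
    (h : DependencyCondition k S B r) (hrk : ∀ i ∈ S, r i ≤ k)
    (hlt : ∀ i ∈ S, k < (B i).card + r i)
    (hslack : ∀ I ⊆ S, 2 ≤ I.card → I ≠ S → ∀ (T : Finset (Fin n)) (ρ : ℕ), ρ ≤ k →
      (∀ i ∈ I, B i ⊆ T) → (∀ i ∈ I, r i ≤ ρ) →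
      ∑ i ∈ I, ((B i).card + r i - k) + k < T.card + ρ)
    {i₀ : ι} (hi₀ : i₀ ∈ S) (hmax : ∀ i ∈ S, r i ≤ r i₀) {j : Fin n} (hj : j ∈ B i₀) :
    DependencyCondition k S (fun i => (B i).erase j)
      (fun i => if j ∈ B i then min (r i + 1) k else r i) := by
  intro J hJ hJne T ρ hρk hT hρ
  have hTB : ∀ i ∈ J, B i ⊆ insert j T := fun i hi => by
    rw [Finset.subset_insert_iff]
    exact hT i hi
  have hTcard := Finset.card_insert_le j T
  have hρr : ∀ i ∈ J, r i ≤ ρ := fun i hi => by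
    have h1 := hρ i hi
    have h2 := hrk i (hJ hi)
    dsimp only at h1
    split_ifs at h1 <;> omega
  have hle : ∀ i ∈ S, ((B i).erase j).card + (if j ∈ B i then min (r i + 1) k else r i) ≤
      (B i).card + r i := by
    intro i _
    split_ifs with h
    · have := Finset.card_erase_add_one h
      omega
    · rw [Finset.erase_eq_of_notMem h]
  have hsum : ∑ i ∈ J, (((B i).erase j).card + (if j ∈ B i then min (r i + 1) k else r i) - k) ≤
      ∑ i ∈ J, ((B i).card + r i - k) :=
    Finset.sum_le_sum fun i hi => Nat.sub_le_sub_right (hle i (hJ hi)) k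
  dsimp only
  by_cases hJ1 : J.card ≤ 1
  · obtain ⟨i, rfl⟩ := Finset.card_eq_one.1 (le_antisymm hJ1 hJne.card_pos)
    have h1 := Finset.card_le_card (hT i (Finset.mem_singleton_self i))
    have h2 := hρ i (Finset.mem_singleton_self i)
    have h4 := hlt i (hJ (Finset.mem_singleton_self i))
    have h5 := hrk i (hJ (Finset.mem_singleton_self i))
    dsimp only at h1 h2
    rw [Finset.sum_singleton]
    split_ifs at h2 ⊢ with h
    · have := Finset.card_erase_add_one h
      omega
    · rw [Finset.erase_eq_of_notMem h] at h1 ⊢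
      omega
  · by_cases hi₀J : i₀ ∈ J
    · by_cases hk : k ≤ r i₀
      · -- the dimension of the `i₀`-th space drops by one
        have h1 := h J hJ hJne (insert j T) ρ hρk hTB hρr
        have h2 := hlt i₀ hi₀
        have h3 : ∑ i ∈ J, (((B i).erase j).card +
            (if j ∈ B i then min (r i + 1) k else r i) - k) <
            ∑ i ∈ J, ((B i).card + r i - k) := by
          refine Finset.sum_lt_sum (fun i hi => Nat.sub_le_sub_right (hle i (hJ hi)) k)
            ⟨i₀, hi₀J, ?_⟩
          have := Finset.card_erase_add_one hj
          have := hrk i₀ hi₀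
          rw [if_pos hj]
          omega
        omega
      · have hρ₀ := hρ i₀ hi₀J
        dsimp only at hρ₀
        rw [if_pos hj] at hρ₀
        have := h J hJ hJne (insert j T) (ρ - 1) (by omega) hTB fun i hi => by
          have := hmax i (hJ hi)
          omega
        omega
    · have := hslack J hJ (by omega) (fun h => hi₀J (h ▸ hi₀)) (insert j T) ρ hρk hTB hρr
      omega

/-- The spaces of dependencies are independent as soon as the necessary dimension counts hold. The
induction is on the number `m` of spaces and, for fixed `m`, on the total size `M` of the sets of
columns. -/
theorem indepOn_dependencies (hf0 : ∀ s, f s ≠ 0)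
    (hf : StrictMono fun s => MvPowerSeries.lexOrder (f s)) (m : ℕ) :
    ∀ (M : ℕ) (S : Finset ι) (B : ι → Finset (Fin n)) (r : ι → ℕ), S.card = m →
      ∑ i ∈ S, (B i).card = M → (∀ i ∈ S, r i ≤ k) → (∀ i ∈ S, k ≤ (B i).card + r i) →
      DependencyCondition k S B r →
      IndepOn S fun i => dependencies (evalMatrix f n) (B i) (r i) := by
  induction m using Nat.strong_induction_on with
  | _ m ihm =>
  intro M
  induction M using Nat.strong_induction_on with
  | _ M ihM =>
  intro S B r hm hM hrk hle h
  -- a zero space can be dropped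
  by_cases h0 : ∃ i ∈ S, (B i).card + r i ≤ k
  · obtain ⟨i, hi, hk⟩ := h0
    refine IndepOn.of_erase hi (dependencies_eq_bot hf0 hf _ _ hk) ?_
    exact ihm _ (hm ▸ Finset.card_erase_lt_of_mem hi) _ _ B r rfl rfl
      (fun i hi => hrk i (Finset.mem_of_mem_erase hi))
      (fun i hi => hle i (Finset.mem_of_mem_erase hi))
      fun I hI => h I (hI.trans (Finset.erase_subset _ _))
  push Not at h0
  -- a tight subfamily can be replaced by the dependencies among its union
  by_cases htight : ∃ I ⊆ S, 2 ≤ I.card ∧ I ≠ S ∧ ∃ (T : Finset (Fin n)) (ρ : ℕ), ρ ≤ k ∧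
      (∀ i ∈ I, B i ⊆ T) ∧ (∀ i ∈ I, r i ≤ ρ) ∧
      ∑ i ∈ I, ((B i).card + r i - k) + k = T.card + ρ
  · obtain ⟨I, hIS, hI2, hIne, T, ρ, hρk, hT, hρ, htight⟩ := htight
    have hIlt : I.card < S.card := Finset.card_lt_card (hIS.ssubset_of_ne hIne)
    obtain ⟨i₀, hi₀⟩ : I.Nonempty := Finset.card_pos.1 (by omega)
    have hi₀' : i₀ ∉ S \ I := fun h => (Finset.mem_sdiff.1 h).2 hi₀
    have hne : ∀ i ∈ S \ I, i ≠ i₀ := fun i hi h => hi₀' (h ▸ hi)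
    refine IndepOn.of_replace (X' := fun i => dependencies (evalMatrix f n)
      (Function.update B i₀ T i) (Function.update r i₀ ρ i)) hIS hi₀ ?_ ?_ ?_ ?_
    · intro i hi
      simp only [Function.update_of_ne (hne i hi), le_refl]
    · intro i hi
      simp only [Function.update_self]
      exact dependencies_mono _ (hT i hi) (hρ i hi)
    · exact ihm _ (hm ▸ hIlt) _ I B r rfl rfl (fun i hi => hrk i (hIS hi))
        (fun i hi => hle i (hIS hi)) fun J hJ => h J (hJ.trans hIS)
    · refine ihm _ ?_ _ _ _ _ rfl rfl ?_ ?_ (h.replace hIS hi₀ hT hρ htight)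
      · rw [Finset.card_insert_of_notMem hi₀', Finset.card_sdiff_of_subset hIS]
        omega
      · intro i hi
        rcases Finset.mem_insert.1 hi with rfl | hi
        · simpa only [Function.update_self] using hρk
        · simp only [Function.update_of_ne (hne i hi)]
          exact hrk i (Finset.mem_sdiff.1 hi).1
      · intro i hi
        rcases Finset.mem_insert.1 hi with rfl | hi
        · simp only [Function.update_self]
          omega
        · simp only [Function.update_of_ne (hne i hi)]
          exact hle i (Finset.mem_sdiff.1 hi).1
  have hslack : ∀ I ⊆ S, 2 ≤ I.card → I ≠ S → ∀ (T : Finset (Fin n)) (ρ : ℕ), ρ ≤ k →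
      (∀ i ∈ I, B i ⊆ T) → (∀ i ∈ I, r i ≤ ρ) →
      ∑ i ∈ I, ((B i).card + r i - k) + k < T.card + ρ := by
    intro I hI hI2 hIne T ρ hρk hT hρ
    exact lt_of_le_of_ne (h I hI (Finset.card_pos.1 (by omega)) T ρ hρk hT hρ) fun heq =>
      htight ⟨I, hI, hI2, hIne, T, ρ, hρk, hT, hρ, heq⟩
  by_cases hS : S.card ≤ 1
  · exact IndepOn.of_card_le_one _ hS
  obtain ⟨i₀, hi₀, hmax⟩ := S.exists_max_image r (Finset.card_pos.1 (by omega))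
  -- a point from a set with the largest number of unit vectors is moved to the origin
  obtain ⟨j, hj⟩ : (B i₀).Nonempty := by
    have := h0 i₀ hi₀
    have := hrk i₀ hi₀
    exact Finset.card_pos.1 (by omega)
  have hind := ihM (∑ i ∈ S, ((B i).erase j).card) ?_ S (fun i => (B i).erase j)
    (fun i => if j ∈ B i then min (r i + 1) k else r i) hm rfl ?_ ?_
    (h.degenerate hrk h0 hslack hi₀ hmax hj)
  · intro c hc hsum
    by_contra! hne
    -- two sets which come with all unit vectors are disjoint
    have huniq : ∀ i ∈ S, ∀ i' ∈ S, j ∈ B i → j ∈ B i' → k ≤ r i → k ≤ r i' → i = i' := by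
      intro i hi i' hi' hji hji' hk hk'
      by_contra hne
      have h1 := h {i, i'} (by simp [Finset.insert_subset_iff, hi, hi']) (by simp) (B i ∪ B i') k
        le_rfl (by simp) (by simp [hrk i hi, hrk i' hi'])
      rw [Finset.sum_pair hne] at h1
      have h2 := Finset.card_union_add_card_inter (B i) (B i')
      have h3 : 0 < (B i ∩ B i').card := Finset.card_pos.2 ⟨j, Finset.mem_inter.2 ⟨hji, hji'⟩⟩
      omega
    obtain ⟨c', hsum', ⟨i, hi, hne'⟩, hc'⟩ :=
      exists_dependencies_degeneration hf0 hf j S huniq hc hne hsum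
    exact hne' (hind c' hc' hsum' i hi)
  · rw [← hM]
    exact Finset.sum_lt_sum (fun i _ => Finset.card_le_card (Finset.erase_subset _ _))
      ⟨i₀, hi₀, Finset.card_erase_lt_of_mem hj⟩
  · intro i hi
    have := hrk i hi
    split_ifs <;> omega
  · intro i hi
    have h1 := h0 i hi
    split_ifs with hji
    · have := Finset.card_erase_add_one hji
      omega
    · rw [Finset.erase_eq_of_notMem hji]
      omega

end

/-! ### The block matrix and its kernels -/

section

variable {R : Type*} [CommRing R] {k n ℓ : ℕ}

theorem vecMul_blockMatrix_eq_zero_iff (V : Matrix (Fin k) (Fin n) R) (A : Fin ℓ → Finset (Fin n))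
    (v : Fin ℓ × Fin k → R) :
    v ᵥ* blockMatrix V A = 0 ↔ ∑ i, (fun s => v (i, s)) = 0 ∧
      ∀ i, (fun s => v (i, s)) ∈ annihilator V (A i) 0 := by
  have h1 : ∀ s, (v ᵥ* blockMatrix V A) (Sum.inl s) = ∑ i, v (i, s) := by
    intro s
    simp [Matrix.vecMul, dotProduct, blockMatrix, Fintype.sum_prod_type]
  have h2 : ∀ i (j : {j : Fin n // j ∈ A i}), (v ᵥ* blockMatrix V A) (Sum.inr ⟨i, j⟩) =
      ∑ s, v (i, s) * V s j := by
    intro i j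
    simp only [Matrix.vecMul, dotProduct, blockMatrix, Fintype.sum_prod_type, Matrix.of_apply,
      Sum.elim_inr]
    rw [Finset.sum_eq_single i]
    · simp
    · intro i' _ hi'
      simp [hi']
    · simp
  constructor
  · intro h
    refine ⟨?_, fun i => ⟨fun s hs => absurd hs (Nat.not_lt_zero _), fun j hj => ?_⟩⟩
    · ext1 s
      rw [Finset.sum_apply, ← h1, h]
      rfl
    · rw [← h2 i ⟨j, hj⟩, h]
      rfl
  · rintro ⟨hsum, hann⟩
    ext1 (s | ⟨i, j⟩)
    · rw [h1]
      have := congrFun hsum s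
      rwa [Finset.sum_apply] at this
    · rw [h2]
      exact (hann i).2 j j.2

theorem mulVec_blockMatrix_inl_inr (V : Matrix (Fin k) (Fin n) R) (A : Fin ℓ → Finset (Fin n))
    (x : Fin k → R) (y : (Σ i : Fin ℓ, {j : Fin n // j ∈ A i}) → R) (i : Fin ℓ) (s : Fin k) :
    (blockMatrix V A *ᵥ Sum.elim x y) (i, s) = x s + ∑ j : {j // j ∈ A i}, V s j * y ⟨i, j⟩ := by
  simp only [Matrix.mulVec, dotProduct, blockMatrix, Matrix.of_apply, Fintype.sum_sum_type,
    Sum.elim_inl, Sum.elim_inr, Fintype.sum_sigma]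
  congr 1
  · simp
  · rw [Finset.sum_eq_single i]
    · simp
    · intro i' _ hi'
      simp [hi'.symm]
    · simp

theorem nonempty_equiv_blockMatrix (A : Fin ℓ → Finset (Fin n))
    (hA : k + ∑ i, (A i).card = ℓ * k) :
    Nonempty (Fin ℓ × Fin k ≃ Fin k ⊕ (Σ i : Fin ℓ, {j : Fin n // j ∈ A i})) := by
  rw [← Fintype.card_eq]
  simp [hA]

/-- A square block matrix is nonsingular if and only if its left kernel is trivial, that is, if the
annihilators of the columns in the sets `A i` are independent. -/
theorem hasNonzeroDet_blockMatrix_iff [Nontrivial R] [NoZeroDivisors R]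
    (V : Matrix (Fin k) (Fin n) R)
    (A : Fin ℓ → Finset (Fin n)) (hA : k + ∑ i, (A i).card = ℓ * k) :
    HasNonzeroDet (blockMatrix V A) ↔ IndepOn Finset.univ fun i => annihilator V (A i) 0 := by
  have hsub : ∀ (e : Fin ℓ × Fin k ≃ Fin k ⊕ (Σ i : Fin ℓ, {j : Fin n // j ∈ A i}))
      (v : Fin ℓ × Fin k → R), v ᵥ* (blockMatrix V A).submatrix id e = 0 ↔
      v ᵥ* blockMatrix V A = 0 := by
    intro e v
    have : v ᵥ* (blockMatrix V A).submatrix id e = (v ᵥ* blockMatrix V A) ∘ e := rfl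
    rw [this]
    constructor
    · intro h
      ext1 c
      simpa using congrFun h (e.symm c)
    · intro h
      rw [h]
      rfl
  constructor
  · rintro ⟨e, he⟩ g hg hsum i _
    have := Matrix.eq_zero_of_vecMul_eq_zero he ((hsub e (fun p => g p.1 p.2)).2
      ((vecMul_blockMatrix_eq_zero_iff V A _).2 ⟨hsum, fun i => hg i (Finset.mem_univ i)⟩))
    ext1 s
    exact congrFun this (i, s)
  · intro h
    obtain ⟨e⟩ := nonempty_equiv_blockMatrix A hA
    refine ⟨e, fun hdet => ?_⟩
    have := NoZeroDivisors.to_isDomain R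
    obtain ⟨v, hv0, hv⟩ := Matrix.exists_vecMul_eq_zero_iff.2 hdet
    rw [hsub, vecMul_blockMatrix_eq_zero_iff] at hv
    refine hv0 (funext fun p => ?_)
    exact congrFun (h _ (fun i _ => hv.2 i) hv.1 p.1 (Finset.mem_univ _)) p.2

theorem HasNonzeroDet.of_map {R' : Type*} [CommRing R'] (φ : R →+* R')
    {V : Matrix (Fin k) (Fin n) R} {A : Fin ℓ → Finset (Fin n)}
    (h : HasNonzeroDet (blockMatrix (V.map φ) A)) : HasNonzeroDet (blockMatrix V A) := by
  obtain ⟨e, he⟩ := h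
  refine ⟨e, fun h0 => he ?_⟩
  have hmap : (blockMatrix (V.map φ) A).submatrix id e =
      φ.mapMatrix ((blockMatrix V A).submatrix id e) := by
    ext p c
    simp only [Matrix.submatrix_apply, RingHom.mapMatrix_apply, Matrix.map_apply, blockMatrix,
      Matrix.of_apply]
    rcases e c with s | ⟨i, j⟩
    · simp [apply_ite φ]
    · simp [apply_ite φ]
  rw [hmap, ← RingHom.map_det, h0, map_zero]

end

section

variable {K : Type*} [Field K] {k n ℓ : ℕ}

theorem mem_colSpan_iff {V : Matrix (Fin k) (Fin n) K} {A : Finset (Fin n)} {x : Fin k → K} :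
    x ∈ colSpan V A ↔ ∃ c : {j // j ∈ A} → K, ∀ s, x s = ∑ j, V s j.1 * c j := by
  rw [colSpan, Submodule.mem_span_image_finset_iff_exists_fun]
  refine exists_congr fun c => ?_
  rw [funext_iff]
  refine forall_congr' fun s => ?_
  rw [Finset.sum_apply, eq_comm]
  simp [Matrix.col, mul_comm]

theorem eq_zero_of_dependencies_eq_bot {V : Matrix (Fin k) (Fin n) K} {A : Finset (Fin n)}
    (h : dependencies V A 0 = ⊥) {c : {j // j ∈ A} → K} (hc : ∀ s, ∑ j, V s j.1 * c j = 0) :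
    c = 0 := by
  have hdep : (fun j => if hj : j ∈ A then c ⟨j, hj⟩ else 0) ∈ dependencies V A 0 := by
    refine ⟨fun j hj => dif_neg hj, fun s _ => ?_⟩
    rw [← Finset.sum_subset (Finset.subset_univ A)
      (fun j _ hj => mul_eq_zero_of_left (dif_neg hj) _), ← Finset.sum_coe_sort, ← hc s]
    refine Finset.sum_congr rfl fun j _ => ?_
    simp [mul_comm]
  rw [h, Submodule.mem_bot] at hdep
  ext1 j
  simpa using congrFun hdep j

theorem HasNonzeroDet.iInf_colSpan_eq_bot {V : Matrix (Fin k) (Fin n) K}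
    {A : Fin ℓ → Finset (Fin n)} (h : HasNonzeroDet (blockMatrix V A)) :
    ⨅ i, colSpan V (A i) = ⊥ := by
  obtain ⟨e, he⟩ := h
  rw [Submodule.eq_bot_iff]
  intro x hx
  rw [Submodule.mem_iInf] at hx
  choose c hc using fun i => mem_colSpan_iff.1 (hx i)
  have hv : blockMatrix V A *ᵥ Sum.elim x (fun p => -c p.1 p.2) = 0 := by
    ext1 ⟨i, s⟩
    rw [mulVec_blockMatrix_inl_inr, hc i s]
    simp
  have := Matrix.eq_zero_of_mulVec_eq_zero he
    (v := Sum.elim x (fun p => -c p.1 p.2) ∘ e) (by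
      rw [Matrix.submatrix_mulVec_equiv]
      simp only [Function.comp_assoc, Equiv.self_comp_symm, Function.comp_id, hv])
  ext1 s
  simpa using congrFun this (e.symm (Sum.inl s))

theorem hasNonzeroDet_of_iInf_colSpan_eq_bot {V : Matrix (Fin k) (Fin n) K}
    {A : Fin ℓ → Finset (Fin n)} (hA : k + ∑ i, (A i).card = ℓ * k)
    (h : ⨅ i, colSpan V (A i) = ⊥) (hV : ∀ i, dependencies V (A i) 0 = ⊥) :
    HasNonzeroDet (blockMatrix V A) := by
  obtain ⟨e⟩ := nonempty_equiv_blockMatrix A hA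
  refine ⟨e, fun hdet => ?_⟩
  obtain ⟨v, hv0, hv⟩ := Matrix.exists_mulVec_eq_zero_iff.2 hdet
  obtain ⟨x, y, hxy⟩ : ∃ x y, v ∘ e.symm = Sum.elim x y :=
    ⟨_, _, (Sum.elim_comp_inl_inr _).symm⟩
  rw [Matrix.submatrix_mulVec_equiv, hxy, Function.comp_id] at hv
  have hv' : ∀ i s, x s + ∑ j : {j // j ∈ A i}, V s j * y ⟨i, j⟩ = 0 := fun i s => by
    rw [← mulVec_blockMatrix_inl_inr, hv]
    rfl
  have hx : x = 0 := by
    rw [← Submodule.mem_bot (R := K), ← h, Submodule.mem_iInf]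
    refine fun i => mem_colSpan_iff.2 ⟨fun j => -y ⟨i, j⟩, fun s => ?_⟩
    rw [eq_neg_of_add_eq_zero_left (hv' i s)]
    simp
  have hy : ∀ i j, y ⟨i, j⟩ = 0 := by
    intro i j
    refine congrFun (eq_zero_of_dependencies_eq_bot (hV i) (c := fun j => y ⟨i, j⟩) fun s => ?_) j
    have := hv' i s
    rwa [hx, Pi.zero_apply, zero_add] at this
  apply hv0
  have h0 : v ∘ e.symm = 0 := by
    rw [hxy, hx]
    ext1 (s | ⟨i, j⟩)
    · rfl
    · exact hy i j
  ext1 p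
  simpa using congrFun h0 (e p)

theorem finrank_annihilator_add_rank (V : Matrix (Fin k) (Fin n) K) (A : Finset (Fin n)) :
    (V.submatrix id ((↑) : {j // j ∈ A} → Fin n))ᵀ.rank +
      Module.finrank K (annihilator V A 0) = k := by
  have hker : annihilator V A 0 =
      LinearMap.ker (V.submatrix id ((↑) : {j // j ∈ A} → Fin n))ᵀ.mulVecLin := by
    ext g
    rw [LinearMap.mem_ker, Matrix.mulVecLin_apply, mem_annihilator, funext_iff]
    simp [Matrix.mulVec, dotProduct, mul_comm]
  rw [hker, Matrix.rank, LinearMap.finrank_range_add_finrank_ker]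
  simp

theorem le_finrank_annihilator_add_card (V : Matrix (Fin k) (Fin n) K) (A : Finset (Fin n)) :
    k ≤ Module.finrank K (annihilator V A 0) + A.card := by
  have h1 := finrank_annihilator_add_rank V A
  have h2 := (V.submatrix id ((↑) : {j // j ∈ A} → Fin n))ᵀ.rank_le_card_height
  rw [Fintype.card_coe] at h2
  omega

theorem finrank_annihilator_add_card {V : Matrix (Fin k) (Fin n) K} {A : Finset (Fin n)}
    (h : dependencies V A 0 = ⊥) : Module.finrank K (annihilator V A 0) + A.card = k := by
  have h1 := finrank_annihilator_add_rank V A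
  rw [LinearIndependent.rank_matrix, Fintype.card_coe] at h1
  · omega
  rw [Fintype.linearIndependent_iff]
  intro c hc
  refine congrFun (eq_zero_of_dependencies_eq_bot h fun s => ?_)
  have := congrFun hc s
  rw [Finset.sum_apply] at this
  rw [← this.trans (Pi.zero_apply s)]
  refine Finset.sum_congr rfl fun j _ => ?_
  simp [mul_comm]

end

theorem IndepOn.mono {ι R E : Type*} [Semiring R] [AddCommMonoid E] [Module R E]
    {S I : Finset ι} {X : ι → Submodule R E} (h : IndepOn S X) (hI : I ⊆ S) : IndepOn I X := by
  classical
  intro g hg hsum i hi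
  have := h (fun i => if i ∈ I then g i else 0) (fun i _ => ?_) ?_ i (hI hi)
  · rwa [if_pos hi] at this
  · split_ifs with h
    · exact hg i h
    · exact Submodule.zero_mem _
  · rw [← Finset.sum_subset hI (fun i _ hi => if_neg hi), ← hsum]
    exact Finset.sum_congr rfl fun i hi => if_pos hi

theorem IndepOn.of_injective {ι R E E' : Type*} [Semiring R] [AddCommMonoid E] [Module R E]
    [AddCommMonoid E'] [Module R E'] {S : Finset ι} {X : ι → Submodule R E}
    {X' : ι → Submodule R E'} (h : IndepOn S X') {φ : E →ₗ[R] E'} (hφ : Function.Injective φ)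
    (hX : ∀ i ∈ S, X i ≤ (X' i).comap φ) : IndepOn S X := by
  intro g hg hsum i hi
  apply hφ
  rw [map_zero]
  exact h (fun i => φ (g i)) (fun i hi => hX i hi (hg i hi))
    (by rw [← map_sum, hsum, map_zero]) i hi

theorem IndepOn.sum_finrank_le {ι K E : Type*} [Field K] [AddCommGroup E] [Module K E]
    [Module.Finite K E] {I : Finset ι} {X : ι → Submodule K E} (h : IndepOn I X)
    {Z : Submodule K E} (hZ : ∀ i ∈ I, X i ≤ Z) :
    ∑ i ∈ I, Module.finrank K (X i) ≤ Module.finrank K Z := by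
  classical
  let Φ : (∀ i : I, X i) →ₗ[K] Z :=
    ∑ i : I, (Submodule.inclusion (hZ i i.2)).comp (LinearMap.proj i)
  have hΦ : ∀ x, ((Φ x : Z) : E) = ∑ i : I, (x i : E) := by
    intro x
    simp [Φ, LinearMap.sum_apply]
  have hinj : Function.Injective Φ := by
    rw [injective_iff_map_eq_zero]
    intro x hx
    have key := h (fun i => if hi : i ∈ I then (x ⟨i, hi⟩ : E) else 0) (fun i hi => ?_) ?_
    · ext i
      simpa using key i i.2
    · simp [hi]
    · rw [← Finset.sum_coe_sort]
      simpa [hx] using (hΦ x).symm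
  have := LinearMap.finrank_le_finrank_of_injective hinj
  rwa [Module.finrank_pi_fintype, Finset.sum_coe_sort I (fun i => Module.finrank K (X i))] at this

/-! ### The generic matrix -/

section

variable {F : Type*} [Field F] {k n ℓ : ℕ}

theorem genericMatrix_eq_map : genericMatrix F k n =
    (Matrix.mvPolynomialX (Fin k) (Fin n) F).map (algebraMap (MvPolynomial (Fin k × Fin n) F)
      (FractionRing (MvPolynomial (Fin k × Fin n) F))) := by
  ext i j
  simp [genericMatrix]

/-- At most `k` columns of the generic `k × n` matrix are linearly independent: a suitable minor
specialises to the determinant of the identity matrix. -/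
theorem dependencies_genericMatrix_eq_bot {A : Finset (Fin n)} (hA : A.card ≤ k) :
    dependencies (genericMatrix F k n) A 0 = ⊥ := by
  classical
  obtain ⟨e⟩ : Nonempty ({j // j ∈ A} ↪ Fin k) :=
    Function.Embedding.nonempty_of_card_le (by simpa using hA)
  have hdet : ((genericMatrix F k n).submatrix e ((↑) : {j // j ∈ A} → Fin n)).det ≠ 0 := by
    let N := (Matrix.mvPolynomialX (Fin k) (Fin n) F).submatrix e ((↑) : {j // j ∈ A} → Fin n)
    let φ : MvPolynomial (Fin k × Fin n) F →+* F :=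
      MvPolynomial.eval fun p => if h : p.2 ∈ A then if e ⟨p.2, h⟩ = p.1 then 1 else 0 else 0
    have hN : φ.mapMatrix N = 1 := by
      ext a b
      simp [N, φ, Matrix.one_apply, eq_comm]
    have h1 : N.det ≠ 0 := by
      intro h
      have := congrArg φ h
      rw [RingHom.map_det, hN, Matrix.det_one, map_zero] at this
      exact one_ne_zero this
    have h2 : (genericMatrix F k n).submatrix e ((↑) : {j // j ∈ A} → Fin n) =
        (algebraMap (MvPolynomial (Fin k × Fin n) F)
          (FractionRing (MvPolynomial (Fin k × Fin n) F))).mapMatrix N := by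
      rw [genericMatrix_eq_map]
      rfl
    rw [h2, ← RingHom.map_det]
    exact (map_ne_zero_iff _ (IsFractionRing.injective _ _)).2 h1
  rw [Submodule.eq_bot_iff]
  intro c hc
  have hzero := Matrix.eq_zero_of_mulVec_eq_zero hdet (v := fun j => c j) (by
    ext1 a
    have := hc.2 (e a) (Nat.zero_le _)
    rw [← Finset.sum_subset (Finset.subset_univ A)
      (fun j _ hj => by rw [hc.1 j hj, zero_mul]), ← Finset.sum_coe_sort] at this
    simpa [Matrix.mulVec, dotProduct, mul_comm] using this)
  ext1 j
  by_cases hj : j ∈ A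
  · exact congrFun hzero ⟨j, hj⟩
  · exact hc.1 j hj

theorem genericNullIntersection_iff {A : Fin ℓ → Finset (Fin n)}
    (hA : ∀ i, (A i).card ≤ k) (hsum : k + ∑ i, (A i).card = ℓ * k) :
    GenericNullIntersection F k A ↔ HasNonzeroDet (blockMatrix (genericMatrix F k n) A) :=
  ⟨fun h => hasNonzeroDet_of_iInf_colSpan_eq_bot hsum h
    fun i => dependencies_genericMatrix_eq_bot (hA i), fun h => h.iInf_colSpan_eq_bot⟩

/-- A nonzero determinant for some matrix forces one for the generic matrix. -/
theorem genericNullIntersection_of_hasNonzeroDet {R : Type*} [CommRing R] [Algebra F R]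
    {V : Matrix (Fin k) (Fin n) R} {A : Fin ℓ → Finset (Fin n)}
    (h : HasNonzeroDet (blockMatrix V A)) : GenericNullIntersection F k A := by
  have h1 : HasNonzeroDet (blockMatrix (Matrix.mvPolynomialX (Fin k) (Fin n) F) A) := by
    refine HasNonzeroDet.of_map (MvPolynomial.aeval fun p => V p.1 p.2).toRingHom ?_
    convert h
    ext i j
    simp
  apply HasNonzeroDet.iInf_colSpan_eq_bot
  obtain ⟨e, he⟩ := h1
  refine ⟨e, ?_⟩
  have hmap : (blockMatrix (genericMatrix F k n) A).submatrix id e =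
      (algebraMap (MvPolynomial (Fin k × Fin n) F)
        (FractionRing (MvPolynomial (Fin k × Fin n) F))).mapMatrix
      ((blockMatrix (Matrix.mvPolynomialX (Fin k) (Fin n) F) A).submatrix id e) := by
    ext p c
    simp only [Matrix.submatrix_apply, RingHom.mapMatrix_apply, Matrix.map_apply, blockMatrix,
      Matrix.of_apply, genericMatrix_eq_map]
    rcases e c with s | ⟨i, j⟩
    · simp [apply_ite (algebraMap (MvPolynomial (Fin k × Fin n) F) _)]
    · simp [apply_ite (algebraMap (MvPolynomial (Fin k × Fin n) F) _)]
  rw [hmap, ← RingHom.map_det]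
  exact (map_ne_zero_iff _ (IsFractionRing.injective _ _)).2 he

/-- For the generic matrix, the necessary dimension counts hold. -/
theorem GenericNullIntersection.annihilatorCondition {A : Fin ℓ → Finset (Fin n)}
    (hA : ∀ i, (A i).card ≤ k) (hsum : k + ∑ i, (A i).card = ℓ * k)
    (h : GenericNullIntersection F k A) :
    AnnihilatorCondition k Finset.univ A fun _ => 0 := by
  rw [genericNullIntersection_iff hA hsum, hasNonzeroDet_blockMatrix_iff _ _ hsum] at h
  intro I _ hne T ρ hT hρ
  obtain ⟨i₀, hi₀⟩ := hne
  have h0 : ρ ≤ 0 := hρ i₀ hi₀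
  have h1 := (h.mono (Finset.subset_univ I)).sum_finrank_le
    (Z := annihilator (genericMatrix F k n) T 0) fun i hi => annihilator_mono _ (hT i hi) le_rfl
  have h2 := finrank_annihilator_add_card (dependencies_genericMatrix_eq_bot (F := F)
    ((Finset.card_le_card (hT i₀ hi₀)).trans (hA i₀)))
  have h3 : ∑ i ∈ I, (k - ((A i).card + 0)) ≤
      ∑ i ∈ I, Module.finrank (FractionRing (MvPolynomial (Fin k × Fin n) F))
        (annihilator (genericMatrix F k n) (A i) 0) := by
    refine Finset.sum_le_sum fun i _ => ?_
    have := le_finrank_annihilator_add_card (genericMatrix F k n) (A i)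
    omega
  simp only [add_zero] at h3 ⊢
  omega

end

/-! ### Linearly independent tuples of power series -/

section

variable {F : Type*} [Field F] {d k n ℓ : ℕ} {f : Fin k → MvPowerSeries (Fin d) F}

theorem evalMatrix_eq_sum_smul {b : Fin k → MvPowerSeries (Fin d) F} {H : Matrix (Fin k) (Fin k) F}
    (h : ∀ s, f s = ∑ i, H s i • b i) (s : Fin k) (j : Fin n) :
    evalMatrix f n s j = ∑ i, H s i • evalMatrix b n i j := by
  change MvPowerSeries.rename _ (f s) = ∑ i, H s i • MvPowerSeries.rename _ (b i)
  rw [h s, map_sum]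
  exact Finset.sum_congr rfl fun i _ => map_smul _ _ _

/-- A change of basis of the span of the power series turns annihilators into annihilators. -/
theorem exists_annihilator_le_comap {b : Fin k → MvPowerSeries (Fin d) F}
    {G H : Matrix (Fin k) (Fin k) F} (hH : ∀ s, f s = ∑ i, H s i • b i) (hHG : H * G = 1) (n : ℕ) :
    ∃ φ : (Fin k → MvPowerSeries (Fin n × Fin d) F) →ₗ[MvPowerSeries (Fin n × Fin d) F]
        (Fin k → MvPowerSeries (Fin n × Fin d) F), Function.Injective φ ∧
      ∀ A, annihilator (evalMatrix f n) A 0 ≤ (annihilator (evalMatrix b n) A 0).comap φ := by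
  let C : F →+* MvPowerSeries (Fin n × Fin d) F := MvPowerSeries.C
  refine ⟨Matrix.vecMulLinear (H.map C), fun g g' hg => ?_, fun A g hg =>
    ⟨fun s hs => absurd hs (Nat.not_lt_zero _), fun j hj => ?_⟩⟩
  · have hC : H.map C * G.map C = 1 := by
      rw [← Matrix.map_mul, hHG, Matrix.map_one _ (map_zero C) (map_one C)]
    have := congrArg (fun v => v ᵥ* G.map C) hg
    simpa [Matrix.vecMul_vecMul, hC] using this
  · rw [← hg.2 j hj]
    simp_rw [evalMatrix_eq_sum_smul hH, Finset.mul_sum, MvPowerSeries.smul_eq_C_mul]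
    rw [Finset.sum_comm]
    simp only [Matrix.vecMulLinear_apply, Matrix.vecMul, dotProduct, Finset.sum_mul,
      Matrix.map_apply, mul_assoc]
    rfl

theorem indepOn_annihilator_of_linearIndependent (hf : LinearIndependent F f)
    {A : Fin ℓ → Finset (Fin n)} (hA : ∀ i, (A i).card ≤ k)
    (h : AnnihilatorCondition k Finset.univ A fun _ => 0) :
    IndepOn Finset.univ fun i => annihilator (evalMatrix f n) (A i) 0 := by
  obtain ⟨b, G, H, hb0, hb, -, hH, hHG⟩ := exists_strictMono_lexOrder hf
  obtain ⟨φ, hφ, hle⟩ := exists_annihilator_le_comap hH hHG n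
  exact (indepOn_annihilator (n := n) hb0 hb _ _ Finset.univ A (fun _ => 0) rfl rfl
    (fun i _ => hA i) h).of_injective hφ fun i _ => hle (A i)

theorem indepOn_dependencies_of_linearIndependent (hf : LinearIndependent F f)
    {B : Fin ℓ → Finset (Fin n)} (hB : ∀ i, k ≤ (B i).card)
    (h : DependencyCondition k Finset.univ B fun _ => 0) :
    IndepOn Finset.univ fun i => dependencies (evalMatrix f n) (B i) 0 := by
  obtain ⟨b, G, H, hb0, hb, hG, -, -⟩ := exists_strictMono_lexOrder hf
  have hind := indepOn_dependencies (n := n) hb0 hb _ _ Finset.univ B (fun _ => 0) rfl rfl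
    (fun i _ => Nat.zero_le k) (fun i _ => hB i) h
  intro c hc hsum
  refine hind c (fun i hi => ⟨(hc i hi).1, fun s _ => ?_⟩) hsum
  simp_rw [evalMatrix_eq_sum_smul hG, Finset.mul_sum]
  rw [Finset.sum_comm]
  refine Finset.sum_eq_zero fun t _ => ?_
  simp_rw [mul_smul_comm]
  rw [← Finset.smul_sum, (hc i hi).2 t (Nat.zero_le _), smul_zero]

theorem indepOn_dependencies_evalMatrixFrac
    {B : Fin ℓ → Finset (Fin n)}
    (h : IndepOn Finset.univ fun i => dependencies (evalMatrix f n) (B i) 0) :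
    IndepOn Finset.univ fun i => dependencies (evalMatrixFrac f n) (B i) 0 := by
  intro c hc hsum
  obtain ⟨b, hb⟩ := IsLocalization.exist_integer_multiples_of_finite
    (nonZeroDivisors (MvPowerSeries (Fin n × Fin d) F)) fun p : Fin ℓ × Fin n => c p.1 p.2
  choose c' hc' using hb
  have hinj := IsFractionRing.injective (MvPowerSeries (Fin n × Fin d) F)
    (FractionRing (MvPowerSeries (Fin n × Fin d) F))
  have hb0 : algebraMap (MvPowerSeries (Fin n × Fin d) F)
      (FractionRing (MvPowerSeries (Fin n × Fin d) F)) b ≠ 0 :=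
    (map_ne_zero_iff _ hinj).2 (nonZeroDivisors.ne_zero b.2)
  simp_rw [Algebra.smul_def] at hc'
  have key := h (fun i j => c' (i, j)) (fun i hi => ⟨fun j hj => hinj ?_, fun s _ => hinj ?_⟩) ?_
  · intro i hi
    ext1 j
    have := hc' (i, j)
    rw [show c' (i, j) = 0 from congrFun (key i hi) j, map_zero] at this
    exact (mul_eq_zero.1 this.symm).resolve_left hb0
  · rw [hc', (hc i hi).1 j hj, mul_zero, map_zero]
  · rw [map_sum, map_zero]
    have : ∀ j, algebraMap _ (FractionRing (MvPowerSeries (Fin n × Fin d) F))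
        (c' (i, j) * evalMatrix f n s j) = algebraMap _ _ b.1 * (c i j * evalMatrixFrac f n s j) :=
      fun j => by
        rw [map_mul, hc', mul_assoc]
        rfl
    simp_rw [this]
    rw [← Finset.mul_sum, (hc i hi).2 s (Nat.zero_le _), mul_zero]
  · ext1 j
    apply hinj
    rw [Finset.sum_apply, map_sum]
    simp_rw [hc']
    have := congrFun hsum j
    rw [Finset.sum_apply] at this
    rw [← Finset.mul_sum, this, Pi.zero_apply, Pi.zero_apply, mul_zero, map_zero]

theorem isMDSOrder_of_linearIndependent (hf : LinearIndependent F f) (hℓ : 1 ≤ ℓ) :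
    IsMDSOrder ℓ f := by
  intro A hA hsum
  have hsum' : k + ∑ i, (A i).card = ℓ * k := by
    obtain ⟨m, rfl⟩ := Nat.exists_eq_add_of_le' hℓ
    rw [hsum, Nat.add_sub_cancel]
    ring
  refine ⟨fun h => ?_, genericNullIntersection_of_hasNonzeroDet⟩
  rw [hasNonzeroDet_blockMatrix_iff _ _ hsum']
  exact indepOn_annihilator_of_linearIndependent hf hA (h.annihilatorCondition hA hsum')

/-- For disjoint blocks of `k` columns and the empty set, the generic intersection is zero, while a
linear relation between the `f s` is orthogonal to all columns. -/
theorem linearIndependent_of_isMDSOrder (hℓ : 2 ≤ ℓ) (h : IsMDSOrder ℓ f) :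
    LinearIndependent F f := by
  obtain ⟨m, rfl⟩ := Nat.exists_eq_add_of_le' hℓ
  let A : Fin (m + 2) → Finset (Fin ((m + 1) * k)) :=
    Fin.cons ∅ fun i => Finset.univ.map ⟨fun s : Fin k => finProdFinEquiv (i, s),
      fun a b hab => by simpa using hab⟩
  have hcard : ∀ i : Fin (m + 1), (A i.succ).card = k := fun i => by simp [A]
  have h0 : A 0 = ∅ := rfl
  have hA : ∀ i, (A i).card ≤ k :=
    Fin.cases (by simp [h0]) fun i => (hcard i).le
  have hsum : ∑ i, (A i).card = (m + 1) * k := by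
    rw [Fin.sum_univ_succ]
    simp [hcard, h0]
  have hnull : GenericNullIntersection F k A := by
    refine eq_bot_iff.2 ((iInf_le _ 0).trans ?_)
    rw [h0, colSpan]
    simp
  have hdet := (h A hA hsum).1 hnull
  rw [hasNonzeroDet_blockMatrix_iff _ _ (by rw [hsum]; ring)] at hdet
  rw [Fintype.linearIndependent_iff]
  intro c hc s
  let u : Fin k → MvPowerSeries (Fin ((m + 1) * k) × Fin d) F := fun s => MvPowerSeries.C (c s)
  have hu : ∀ j, ∑ s, u s * evalMatrix f ((m + 1) * k) s j = 0 := by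
    intro j
    have := congrArg (MvPowerSeries.rename (fun t : Fin d => (j, t))) hc
    rw [map_sum, map_zero] at this
    rw [← this]
    refine Finset.sum_congr rfl fun s _ => ?_
    rw [map_smul, MvPowerSeries.smul_eq_C_mul]
    rfl
  have key := hdet (Fin.cons (-u) (Fin.cons u 0)) (fun i _ => ?_) (by simp [Fin.sum_univ_succ]) 0
    (Finset.mem_univ _)
  · have : u s = 0 := by simpa using congrFun key s
    exact (map_eq_zero_iff _ MvPowerSeries.C_injective).1 this
  · refine ⟨fun s hs => absurd hs (Nat.not_lt_zero _), ?_⟩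
    refine Fin.cases ?_ (fun i => Fin.cases ?_ (fun i => ?_) i) i
    · simp [h0]
    · intro j _
      exact hu j
    · intro j _
      simp

theorem rank_evalMatrixFrac (hf : LinearIndependent F f) (hn : k ≤ n) :
    (evalMatrixFrac f n).rank = k := by
  have hinj := IsFractionRing.injective (MvPowerSeries (Fin n × Fin d) F)
    (FractionRing (MvPowerSeries (Fin n × Fin d) F))
  rw [LinearIndependent.rank_matrix, Fintype.card_fin]
  rw [← LinearIndependent.iff_fractionRing (R := MvPowerSeries (Fin n × Fin d) F),
    Fintype.linearIndependent_iff]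
  intro g hg s
  obtain ⟨b, G, H, hb0, hb, -, hH, hHG⟩ := exists_strictMono_lexOrder hf
  obtain ⟨φ, hφ, hle⟩ := exists_annihilator_le_comap hH hHG n
  have hmem : g ∈ annihilator (evalMatrix f n) Finset.univ 0 := by
    refine ⟨fun s hs => absurd hs (Nat.not_lt_zero _), fun j _ => hinj ?_⟩
    have := congrFun hg j
    rw [Finset.sum_apply] at this
    rw [map_sum, map_zero, ← this.trans (Pi.zero_apply j)]
    refine Finset.sum_congr rfl fun s _ => ?_
    rw [map_mul, Pi.smul_apply, Algebra.smul_def]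
    rfl
  have := hle _ hmem
  rw [Submodule.mem_comap, annihilator_eq_bot hb0 hb _ _ (by simpa using hn), Submodule.mem_bot,
    map_eq_zero_iff φ hφ] at this
  exact congrFun this s

end

/-! ### Dual matrices -/

section

variable {K : Type*} [Field K] {k n ℓ : ℕ}

theorem exists_isDualMatrix (V : Matrix (Fin k) (Fin n) K) (hV : V.rank = k) :
    ∃ Q : Matrix (Fin (n - k)) (Fin n) K, IsDualMatrix V Q := by
  have hker : Module.finrank K (LinearMap.ker V.mulVecLin) = n - k := by
    have := LinearMap.finrank_range_add_finrank_ker V.mulVecLin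
    rw [← Matrix.rank, hV, Module.finrank_fintype_fun_eq_card, Fintype.card_fin] at this
    omega
  let b := Module.finBasisOfFinrankEq K (LinearMap.ker V.mulVecLin) hker
  have hb : LinearIndependent K fun i => (b i : Fin n → K) :=
    b.linearIndependent.map' (Submodule.subtype _) (Submodule.ker_subtype _)
  refine ⟨Matrix.of fun i => (b i : Fin n → K), ?_, ?_⟩
  · rw [LinearIndependent.rank_matrix, Fintype.card_fin]
    exact hb
  · ext s i
    exact congrFun (LinearMap.mem_ker.1 (b i).2) s

/-- The rows of a dual matrix identify the annihilators of the columns of the dual matrix with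
spaces of dependencies between the columns of the original matrix. -/
theorem IsDualMatrix.indepOn_annihilator {V : Matrix (Fin k) (Fin n) K}
    {Q : Matrix (Fin (n - k)) (Fin n) K} (hQ : IsDualMatrix V Q) {A : Fin ℓ → Finset (Fin n)}
    (h : IndepOn Finset.univ fun i => dependencies V (A i)ᶜ 0) :
    IndepOn Finset.univ fun i => annihilator Q (A i) 0 := by
  obtain ⟨hrank, horth⟩ := hQ
  have hinj : Function.Injective fun v => v ᵥ* Q := by
    rw [Matrix.vecMul_injective_iff, linearIndependent_iff_card_eq_finrank_span, Set.finrank,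
      ← Matrix.rank_eq_finrank_span_row, hrank, Fintype.card_fin]
  refine h.of_injective (φ := Matrix.vecMulLinear Q) hinj fun i _ g hg =>
    ⟨fun j hj => ?_, fun s _ => ?_⟩
  · rw [Finset.mem_compl, not_not] at hj
    exact hg.2 j hj
  · have h1 : g ᵥ* Q ᵥ* Vᵀ = 0 := by
      rw [Matrix.vecMul_vecMul, ← Matrix.transpose_transpose Q, ← Matrix.transpose_mul, horth]
      simp
    exact congrFun h1 s

theorem AnnihilatorCondition.dependencyCondition {ι : Type*} {S : Finset ι}
    {A : ι → Finset (Fin n)} (hn : k ≤ n) (h : AnnihilatorCondition (n - k) S A fun _ => 0) :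
    DependencyCondition k S (fun i => (A i)ᶜ) fun _ => 0 := by
  intro I hI hne T ρ _ hT _
  have h1 := h I hI hne Tᶜ 0 (fun i hi => compl_le_of_compl_le (hT i hi)) (by simp)
  have h2 : ∀ i, (A i)ᶜ.card + 0 - k = n - k - ((A i).card + 0) := fun i => by
    rw [Finset.card_compl, Fintype.card_fin]
    omega
  have h3 := Finset.card_compl T
  rw [Fintype.card_fin] at h3
  simp only [h2]
  dsimp only at h1
  omega

end

theorem isLDMDS_of_linearIndependent {F : Type*} [Field F] {d k : ℕ}
    {f : Fin k → MvPowerSeries (Fin d) F} (hf : LinearIndependent F f) (ℓ : ℕ) :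
    IsLDMDS ℓ f := by
  intro n hn
  have hrank := rank_evalMatrixFrac hf hn
  refine ⟨hrank, fun A hA hsum => ?_⟩
  have hsum' : (n - k) + ∑ i, (A i).card = (ℓ + 1) * (n - k) := by
    rw [hsum]
    ring
  constructor
  · intro h Q hQ
    rw [hasNonzeroDet_blockMatrix_iff _ _ hsum']
    refine hQ.indepOn_annihilator (indepOn_dependencies_evalMatrixFrac
      (indepOn_dependencies_of_linearIndependent hf (fun i => ?_)
        ((h.annihilatorCondition hA hsum').dependencyCondition hn)))
    have := hA i
    rw [Finset.card_compl, Fintype.card_fin]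
    omega
  · intro h
    obtain ⟨Q, hQ⟩ := exists_isDualMatrix _ hrank
    exact genericNullIntersection_of_hasNonzeroDet (h Q hQ)

end

end HigherOrderMDS


theorem mainTheorem6 {F : Type*} [Field F] (d k : ℕ) (f : Fin k → MvPowerSeries (Fin d) F) :
    (HigherOrderMDS.IsMDS f ↔ ∀ ℓ : ℕ, 2 < ℓ → HigherOrderMDS.IsMDSOrder ℓ f) ∧
    (HigherOrderMDS.IsMDS f → ∀ ℓ : ℕ, 1 ≤ ℓ → HigherOrderMDS.IsLDMDS ℓ f) := by
  refine ⟨⟨fun h ℓ hℓ => ?_, fun h => ?_⟩, fun h ℓ _ => ?_⟩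
  · exact HigherOrderMDS.isMDSOrder_of_linearIndependent
      (HigherOrderMDS.linearIndependent_of_isMDSOrder le_rfl h) (by omega)
  · exact HigherOrderMDS.isMDSOrder_of_linearIndependent
      (HigherOrderMDS.linearIndependent_of_isMDSOrder (by omega) (h 3 (by omega))) (by omega)
  · exact HigherOrderMDS.isLDMDS_of_linearIndependent
      (HigherOrderMDS.linearIndependent_of_isMDSOrder le_rfl h) ℓ
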